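/- **Setting.** Let $D\ge 1$, let $\mathcal A$ be a finite alphabet, let $\mathfrak A\subseteq\mathcal A^{\mathbb Z^D}$ be a subshift of finite type, and let $\Phi:\mathcal A^{\mathbb Z^D}\to\mathcal A^{\mathbb Z^D}$ be a cellular automaton (a continuous map commuting with all shifts) with $\Phi(\mathfrak A)\subseteq\mathfrak A$. Let $q$ be a radius of $\Phi$. Put $\mathbb B(r)=\{-r,\dots,r\}^D$, and let $\mathfrak A_{(r)}$ be the set of $\mathbb B(r)$-blocks occurring in elements of $\mathfrak A$. **Defects.** For a configuration $\mathbf a$ and $r\ge0$ let $\mathbb G_r(\mathbf a)$ be the set of $z\in\mathbb Z^D$ with $\mathbf a_{z+\mathbb B(r)}\in\mathfrak A_{(r)}$. Let $\widetilde{\mathfrak A}$ be the set of all $\mathbf a$ with $\mathbb G_r(\mathbf a)\ne\emptyset$ for all $r$. Call $\mathbf a$ *defective* if $\mathbf a\in\widetilde{\mathfrak A}\setminus\mathfrak A$. The defect of $\mathbf a$ is *$\Phi$-persistent* if $\Phi^t(\mathbf a)$ is defective for all $t\ge0$. Let $\mathbf G_r(\mathbf a)\subseteq\mathbb R^D$ be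 the union of the unit cubes $z+[0,1]^D$ ($z\in\mathbb Z^D$) all of whose corners lie in $\mathbb G_r(\mathbf a)$; so $\mathbf G_s(\mathbf a)\subseteq\mathbf G_r(\mathbf a)$ for $r\le s$. **Tile complexes.** Let $\mathbf X_r$ be the cell complex obtained from the labelled unit cubes $(z+[0,1]^D)\times\{b\}$ ($z\in\mathbb Z^D$, $b\in\mathfrak A_{(r)}$) by gluing the cube $(z,b)$ to the cube $(z+e_d,b')$ along their common facet whenever $b(x+e_d)=b'(x)$ for all $x$ with $x,\,x+e_d\in\mathbb B(r)$. Restriction of blocks gives cellular maps $\mathbf X_s\to\mathbf X_r$ ($r\le s$), $\Phi$ gives cellular maps $\Phi_*:\mathbf X_{r+q}\to\mathbf X_r$, and $\mathbf a$ gives a continuous cellular map $\varsigma^r_{\mathbf a}:\mathbf G_r(\mathbf a)\to\mathbf X_r$ sending a point $p$ of a cube $z+[0,1]^D$ of $\mathbf G_r(\mathbf a)$ to the point $p$ of the cube $(z,\mathbf a_{z+\mathbb B(r)})$. These are compatible with restriction. For $\mathbf c\in\mathfrak A$ let $x_r(\mathbf c)\in\mathbf X_r$ be the corner over $0$ of the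 cube $(0,\mathbf c_{\mathbb B(r)})$. **Groups.** For an abelian group $\mathcal G$, using cellular (cubical) (co)homology, put $$\pi_k(\mathfrak A,\mathbf c)=\varprojlim_r\pi_k(\mathbf X_r,x_r(\mathbf c)),\quad \mathcal H_k(\mathfrak A,\mathcal G)=\varprojlim_r \mathcal H_k(\mathbf X_r,\mathcal G),\quad \mathcal H^k(\mathfrak A,\mathcal G)=\varinjlim_r \mathcal H^k(\mathbf X_r,\mathcal G),$$ $$\mathcal H_k[\mathbb G_\infty(\mathbf a),\mathcal G]=\varprojlim_r \mathcal H_k(\mathbf G_r(\mathbf a),\mathcal G),\qquad \mathcal H^k[\mathbb G_\infty(\mathbf a),\mathcal G]=\varinjlim_r \mathcal H^k(\mathbf G_r(\mathbf a),\mathcal G).$$ The maps $\Phi_*$ induce $\pi_k\Phi:\pi_k(\mathfrak A,\mathbf c)\to\pi_k(\mathfrak A,\Phi(\mathbf c))$ and endomorphisms $\mathcal H_k\Phi$ of $\mathcal H_k(\mathfrak A,\mathcal G)$ and $\mathcal H^k\Phi$ of $\mathcal H^k(\mathfrak A,\mathcal G)$. The maps $\varsigma^r_{\mathbf a}$ induce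 the signatures $\mathcal H_k\mathbf a:\mathcal H_k[\mathbb G_\infty(\mathbf a),\mathcal G]\to\mathcal H_k(\mathfrak A,\mathcal G)$ and $\mathcal H^k\mathbf a:\mathcal H^k(\mathfrak A,\mathcal G)\to\mathcal H^k[\mathbb G_\infty(\mathbf a),\mathcal G]$. A *proper base ray* for $\mathbf a$ is a continuous $\omega:[0,\infty)\to\mathbb R^D$ with $|\omega(t)|\to\infty$ such that for every $r$, $\omega(t)\in\mathbf G_r(\mathbf a)$ for all large $t$. It yields $\pi_k[\mathbb G_\infty(\mathbf a),\omega]=\varprojlim_r\pi_k(\mathbf G_r(\mathbf a),\omega)$, where $\pi_k(\,\cdot\,,\omega)$ means $\pi_k$ based at $\omega(t)$ for any large $t$, different $t$ being identified by transport along $\omega$; the maps $\varsigma^r_{\mathbf a}$ then induce the homotopy signature $\pi_k\mathbf a$ from $\pi_k[\mathbb G_\infty(\mathbf a),\omega]$ to $\varprojlim_r\pi_k(\mathbf X_r,\varsigma^r_{\mathbf a}\circ\omega)$. An element $\mathbf a\in\widetilde{\mathfrak A}$ has a *homotopy* (resp. *homology*, *cohomology*) *defect of codimension $k+1$* if $\pi_k\mathbf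 a$ for some proper base ray (resp. $\mathcal H_k\mathbf a$, $\mathcal H^k\mathbf a$) is nontrivial. **Basepoint-freeness.** $\mathfrak A$ is *basepoint-free in codimension $k+1$* if one of the following holds: (i) for all large $r$ the projection from the vertices of $\mathbf X_r$ to $\mathbb Z^D$ is injective; (ii) $\mathfrak A$ is topologically weakly mixing, $k=1$, and for some $\mathbf c\in\mathfrak A$ the tower $\pi_1(\mathbf X_r,x_r(\mathbf c))$ is abelian, in the sense that for every $r$ there is $s\ge r$ such that the image of $\pi_1(\mathbf X_s,x_s(\mathbf c))$ in $\pi_1(\mathbf X_r,x_r(\mathbf c))$ is abelian; (iii) $\mathfrak A$ is topologically weakly mixing and for some $\mathbf c\in\mathfrak A$ the tower $\pi_1(\mathbf X_r,x_r(\mathbf c))$ is trivial, in the same sense. **Corollary.** Let $k\ge1$. (a) Suppose $\mathfrak A$ is basepoint-free in codimension $k+1$. If $\pi_k\Phi:\pi_k(\mathfrak A,\mathbf c)\to\pi_k(\mathfrak A,\Phi(\mathbf c))$ is injective for some $\mathbf c\in\mathfrak A$, then every homotopy defect of codimension $k+1$ is $\Phi$-persistent. (b) For every abelian group $\mathcal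 G$: if $\mathcal H_k\Phi:\mathcal H_k(\mathfrak A,\mathcal G)\to\mathcal H_k(\mathfrak A,\mathcal G)$ is injective, then every homology defect (with coefficients in $\mathcal G$) of codimension $k+1$ is $\Phi$-persistent. (c) For every abelian group $\mathcal G$: if $\mathcal H^k\Phi:\mathcal H^k(\mathfrak A,\mathcal G)\to\mathcal H^k(\mathfrak A,\mathcal G)$ is surjective, then every cohomology defect (with coefficients in $\mathcal G$) of codimension $k+1$ is $\Phi$-persistent. -/

import Mathlib

open Set Filter Topology
open scoped NNReal unitInterval

namespace CADefect

universe u v v' w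

/-! ### Configurations, subshifts, cellular automata -/

section Symbolic

variable {D : ℕ} {A : Type u}

/-- The lattice `ℤ^D`. -/
abbrev Lattice (D : ℕ) := Fin D → ℤ

/-- Configurations `A^(ℤ^D)`; they carry the product topology when `A` is discrete. -/
abbrev Config (D : ℕ) (A : Type u) := Lattice D → A

/-- The `d`-th unit vector. -/
abbrev unitVec (d : Fin D) : Lattice D := Pi.single d 1

/-- The shift by `v`. -/
def shift (v : Lattice D) (a : Config D A) : Config D A := fun z => a (z + v)

/-- A subshift: closed and invariant under all shifts. -/
def IsSubshift [TopologicalSpace A] (S : Set (Config D A)) : Prop :=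
  IsClosed S ∧ ∀ v : Lattice D, shift v '' S = S

/-- The cube `B(r) = [-r..r]^D`. -/
def box (D r : ℕ) : Set (Lattice D) := {x | ∀ i, |x i| ≤ (r : ℤ)}

/-- Words of shape `B(r)`. -/
abbrev Block (D : ℕ) (A : Type u) (r : ℕ) := box D r → A

/-- The word of `a` on `B(z, r) = z + B(r)`, read as a word of shape `B(r)`. -/
def blockAt (a : Config D A) (r : ℕ) (z : Lattice D) : Block D A r := fun x => a (z + x.1)

/-- The admissible `r`-blocks of `S`. -/
def Adm (S : Set (Config D A)) (r : ℕ) : Set (Block D A r) := (fun a => blockAt a r 0) '' S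

/-- A subshift of finite type. -/
def IsSFT [TopologicalSpace A] (S : Set (Config D A)) : Prop :=
  IsSubshift S ∧ ∃ R : ℕ, 0 < R ∧ S = {a | ∀ z, blockAt a R z ∈ Adm S R}

/-- Topological weak mixing: the shift action on `S × S` is topologically transitive. -/
def IsWeaklyMixing [TopologicalSpace A] (S : Set (Config D A)) : Prop :=
  ∀ U V : Set (Config D A × Config D A), IsOpen U → IsOpen V →
    (U ∩ S ×ˢ S).Nonempty → (V ∩ S ×ˢ S).Nonempty →
      ∃ z : Lattice D, (Prod.map (shift z) (shift z) '' (U ∩ S ×ˢ S) ∩ (V ∩ S ×ˢ S)).Nonempty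

/-- A cellular automaton: a continuous self-map of `A^(ℤ^D)` commuting with all shifts. -/
def IsCA [TopologicalSpace A] (Φ : Config D A → Config D A) : Prop :=
  Continuous Φ ∧ ∀ v a, Φ (shift v a) = shift v (Φ a)

/-- `Φ` is given by a local rule of radius `q`. -/
def HasRadius (Φ : Config D A → Config D A) (q : ℕ) : Prop :=
  ∀ (a b : Config D A) (z w : Lattice D),
    (∀ x ∈ box D q, a (z + x) = b (w + x)) → Φ a z = Φ b w

theorem IsCA.exists_radius [Finite A] [TopologicalSpace A] [DiscreteTopology A]
    {Φ : Config D A → Config D A} (hΦ : IsCA Φ) : ∃ q, HasRadius Φ q := by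
  classical
  have hc : Continuous fun a : Config D A => Φ a 0 := (continuous_apply 0).comp hΦ.1
  have h1 : ∀ a : Config D A, ∃ K : Finset (Lattice D),
      ∀ b : Config D A, (∀ i ∈ K, b i = a i) → Φ b 0 = Φ a 0 := by
    intro a
    have ho : IsOpen {b : Config D A | Φ b 0 = Φ a 0} :=
      (isOpen_discrete {Φ a 0}).preimage hc
    obtain ⟨K, t, ht, hsub⟩ := isOpen_pi_iff.1 ho a rfl
    exact ⟨K, fun b hb => hsub fun i hi => by rw [hb i hi]; exact (ht i hi).2⟩
  choose K hK using h1
  have hopen : ∀ a : Config D A, IsOpen {b : Config D A | ∀ i ∈ K a, b i = a i} := by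
    intro a
    have : {b : Config D A | ∀ i ∈ K a, b i = a i}
        = ⋂ i ∈ K a, {b : Config D A | b i = a i} := by
      ext b; simp
    rw [this]
    refine isOpen_biInter_finset fun i _ => ?_
    have hci : Continuous fun b : Config D A => b i := continuous_apply i
    exact (isOpen_discrete {a i}).preimage hci
  obtain ⟨T, hT⟩ := isCompact_univ.elim_finite_subcover
    (fun a : Config D A => {b : Config D A | ∀ i ∈ K a, b i = a i}) hopen
    (fun b _ => mem_iUnion.2 ⟨b, fun _ _ => rfl⟩)
  let q : ℕ := (T.biUnion K).sup fun x => Finset.univ.sup fun j => (x j).natAbs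
  have hq : ∀ x ∈ T.biUnion K, x ∈ box D q := by
    intro x hx i
    have h2 : (x i).natAbs ≤ Finset.univ.sup fun j => (x j).natAbs :=
      Finset.le_sup (f := fun j => (x j).natAbs) (Finset.mem_univ i)
    have h3 : (Finset.univ.sup fun j => (x j).natAbs) ≤ q :=
      Finset.le_sup (f := fun x : Lattice D => Finset.univ.sup fun j => (x j).natAbs) hx
    rw [Int.abs_eq_natAbs]
    exact_mod_cast h2.trans h3
  have key : ∀ a b : Config D A, (∀ x ∈ box D q, a x = b x) → Φ a 0 = Φ b 0 := by
    intro a b hab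
    obtain ⟨c, hcT, hc'⟩ := mem_iUnion₂.1 (hT (mem_univ a))
    have ha := hK c a hc'
    have hb := hK c b fun i hi => by
      rw [← hab i (hq i (Finset.mem_biUnion.2 ⟨c, hcT, hi⟩))]; exact hc' i hi
    rw [ha, hb]
  refine ⟨q, fun a b z w h => ?_⟩
  have h0 : ∀ (a : Config D A) z, Φ a z = Φ (shift z a) 0 := by
    intro a z; rw [hΦ.2]; simp [shift]
  rw [h0 a z, h0 b w]
  refine key _ _ fun x hx => ?_
  have := h x hx
  simpa [shift, add_comm] using this

/-- A radius of the cellular automaton `Φ`. -/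
noncomputable def IsCA.radius [Finite A] [TopologicalSpace A] [DiscreteTopology A]
    {Φ : Config D A → Config D A} (hΦ : IsCA Φ) : ℕ := hΦ.exists_radius.choose

theorem IsCA.hasRadius [Finite A] [TopologicalSpace A] [DiscreteTopology A]
    {Φ : Config D A → Config D A} (hΦ : IsCA Φ) : HasRadius Φ hΦ.radius :=
  hΦ.exists_radius.choose_spec

/-! ### Defects -/

theorem box_mono {r s : ℕ} (h : r ≤ s) : box D r ⊆ box D s :=
  fun _ hx i => (hx i).trans (by exact_mod_cast h)

/-- Restriction of a word from `B(s)` to `B(r)`. -/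
def Block.restrict {r s : ℕ} (h : r ≤ s) (b : Block D A s) : Block D A r :=
  fun x => b ⟨x.1, box_mono h x.2⟩

theorem Adm.restrict {S : Set (Config D A)} {r s : ℕ} (h : r ≤ s) {b : Block D A s}
    (hb : b ∈ Adm S s) : Block.restrict h b ∈ Adm S r := by
  obtain ⟨a, ha, rfl⟩ := hb
  exact ⟨a, ha, rfl⟩

/-- The defect field of `a` relative to `S`. -/
noncomputable def defectField (S : Set (Config D A)) (a : Config D A) (z : Lattice D) : ℕ∞ :=
  ⨆ r ∈ {r : ℕ | blockAt a r z ∈ Adm S r}, (r : ℕ∞)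

/-- The set `G_r(a)` of sites around which the `r`-block of `a` is admissible. -/
def unflawed (S : Set (Config D A)) (a : Config D A) (r : ℕ) : Set (Lattice D) :=
  {z | blockAt a r z ∈ Adm S r}

theorem unflawed_anti (S : Set (Config D A)) (a : Config D A) {r s : ℕ} (h : r ≤ s) :
    unflawed S a s ⊆ unflawed S a r :=
  fun _ hz => Adm.restrict h hz

/-- For `r > 0`, `G_r(a)` is the set of sites where the defect field is at least `r`. -/
theorem le_defectField_iff (S : Set (Config D A)) (a : Config D A) (z : Lattice D) {r : ℕ}
    (hr : 0 < r) : (r : ℕ∞) ≤ defectField S a z ↔ z ∈ unflawed S a r := by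
  constructor
  · intro h
    by_contra hz
    have hle : defectField S a z ≤ ((r - 1 : ℕ) : ℕ∞) := by
      refine iSup₂_le fun s hs => ?_
      have : s < r := by
        by_contra hsr
        exact hz (unflawed_anti S a (not_lt.1 hsr) hs)
      exact_mod_cast Nat.le_sub_one_of_lt this
    have h2 : r ≤ r - 1 := by exact_mod_cast h.trans hle
    omega
  · intro h
    exact le_iSup₂ (f := fun (s : ℕ) (_ : s ∈ {s : ℕ | blockAt a s z ∈ Adm S s}) => (s : ℕ∞)) r h

/-- The `slightly defective' configurations: the defect field is unbounded. -/
def slightlyDefective (S : Set (Config D A)) : Set (Config D A) :=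
  {a | ⨆ z, defectField S a z = ⊤}

/-- `a` is defective. -/
def IsDefective (S : Set (Config D A)) (a : Config D A) : Prop :=
  a ∈ slightlyDefective S ∧ a ∉ S

/-- The defect of `a` is `Φ`-persistent: all iterates `Φ^t(a)` are defective. -/
def IsPersistent (S : Set (Config D A)) (Φ : Config D A → Config D A) (a : Config D A) : Prop :=
  ∀ t : ℕ, IsDefective S (Φ^[t] a)

end Symbolic

/-! ### Unit cubes and the faces of the canonical cell complex of `ℝ^D` -/

section Geometry

variable {D : ℕ}

/-- The unit cube `z + [0,1]^D`. -/
def unitCube (z : Lattice D) : Set (Fin D → ℝ) := {p | ∀ i, (z i : ℝ) ≤ p i ∧ p i ≤ z i + 1}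

/-- The base points of those unit cubes all of whose corners lie in `Y`. -/
def cubesIn (Y : Set (Lattice D)) : Set (Lattice D) := {z | Icc z (z + 1) ⊆ Y}

/-- The union of the unit cubes all of whose corners lie in `Y`. -/
def thicken (Y : Set (Lattice D)) : Set (Fin D → ℝ) := {p | ∃ z ∈ cubesIn Y, p ∈ unitCube z}

theorem cubesIn_mono {Y Y' : Set (Lattice D)} (h : Y ⊆ Y') : cubesIn Y ⊆ cubesIn Y' :=
  fun _ hz => Subset.trans hz h

theorem cubesIn_subset (Y : Set (Lattice D)) : cubesIn Y ⊆ Y :=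
  fun z hz => hz ⟨le_refl z, fun i => by simp⟩

theorem thicken_mono {Y Y' : Set (Lattice D)} (h : Y ⊆ Y') : thicken Y ⊆ thicken Y' :=
  fun _ ⟨z, hz, hp⟩ => ⟨z, cubesIn_mono h hz, hp⟩

/-- A face of the canonical cell complex of `ℝ^D`: the product of the intervals
`[base i, base i + 1]` for `i ∈ dirs` and of the points `base i` for `i ∉ dirs`. -/
@[ext] structure Face (D : ℕ) where
  base : Lattice D
  dirs : Finset (Fin D)

/-- The facet of `F` with minimal `i`-th coordinate (`F` itself if `i ∉ dirs`). -/
def Face.lower (i : Fin D) (F : Face D) : Face D := ⟨F.base, F.dirs.erase i⟩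

/-- The facet of `F` with maximal `i`-th coordinate (`F` itself if `i ∉ dirs`). -/
def Face.upper (i : Fin D) (F : Face D) : Face D :=
  ⟨if i ∈ F.dirs then F.base + unitVec i else F.base, F.dirs.erase i⟩

/-- `F` is a face of the unit cube at `z`. -/
def Face.InCube (F : Face D) (z : Lattice D) : Prop :=
  ∀ i, F.base i = z i ∨ (i ∉ F.dirs ∧ F.base i = z i + 1)

theorem Face.InCube.lower {F : Face D} {z : Lattice D} (h : F.InCube z) (i : Fin D) :
    (F.lower i).InCube z := by
  intro j
  rcases h j with h | ⟨h, h'⟩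
  · exact Or.inl h
  · exact Or.inr ⟨fun hj => h (Finset.mem_of_mem_erase hj), h'⟩

theorem Face.InCube.upper {F : Face D} {z : Lattice D} (h : F.InCube z) (i : Fin D) :
    (F.upper i).InCube z := by
  intro j
  by_cases hi : i ∈ F.dirs
  · by_cases hj : j = i
    · subst hj
      rcases h j with h | ⟨h, -⟩
      · right; simp [Face.upper, hi, h]
      · exact absurd hi h
    · rcases h j with h | ⟨h, h'⟩
      · left; simp [Face.upper, hi, h, hj]
      · right; simp [Face.upper, hi, h, h', hj]
  · rcases h j with h | ⟨h, h'⟩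
    · left; simp [Face.upper, hi, h]
    · right; simp [Face.upper, hi, h, h']

/-- Two unit cubes of `thicken Y` which meet are joined by a chain of facewise adjacent unit cubes
with base points in `Y` containing their intersection. -/
theorem chain_eq {Y : Set (Lattice D)} {J : Fin D → ℤ → Prop}
    (hJ : ∀ i m n, J i m → J i n → n ≤ m + 1) {α : Sort*}
    (f : ∀ w : Lattice D, w ∈ Y → (∀ i, J i (w i)) → α)
    (hf : ∀ w d h1 h2 h3 h4, f w h1 h2 = f (w + unitVec d) h3 h4)
    {z z' : Lattice D} (hz : z ∈ cubesIn Y) (hz' : z' ∈ cubesIn Y)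
    (Jz : ∀ i, J i (z i)) (Jz' : ∀ i, J i (z' i)) :
    f z (cubesIn_subset Y hz) Jz = f z' (cubesIn_subset Y hz') Jz' := by
  classical
  have up : ∀ z : Lattice D, ∀ hz : z ∈ cubesIn Y, ∀ Jz : ∀ i, J i (z i),
      ∀ T : Finset (Fin D), (∀ i ∈ T, J i (z i + 1)) → ∀ w : Lattice D,
        w = z + (fun i => if i ∈ T then 1 else 0) → ∀ h1 h2,
          f z (cubesIn_subset Y hz) Jz = f w h1 h2 := by
    intro z hz Jz T
    induction T using Finset.induction_on with
    | empty =>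
      intro _ w hw h1 h2
      have : w = z := by rw [hw]; ext i; simp
      subst this; rfl
    | insert j T hj ih =>
      intro hT w hw h1 h2
      let w' : Lattice D := z + (fun i => if i ∈ T then 1 else 0)
      have hw' : w' ∈ Y := hz ⟨fun i => by
          simp only [w', Pi.add_apply]; split_ifs <;> omega, fun i => by
          simp only [w', Pi.add_apply, Pi.one_apply]; split_ifs <;> omega⟩
      have hJ' : ∀ i, J i (w' i) := by
        intro i
        by_cases hi : i ∈ T
        · simpa [w', hi] using hT i (Finset.mem_insert_of_mem hi)
        · simpa [w', hi] using Jz i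
      have e1 := ih (fun i hi => hT i (Finset.mem_insert_of_mem hi)) w' rfl hw' hJ'
      have e2 : w = w' + unitVec j := by
        rw [hw]; ext i
        by_cases hi : i = j
        · subst hi; simp [w', hj]
        · simp [w', hi]
      subst e2
      rw [e1]
      exact hf _ _ _ _ _ _
  have main : ∀ z z' : Lattice D, ∀ hz : z ∈ cubesIn Y, ∀ Jz : ∀ i, J i (z i),
      (∀ i, J i (z' i)) → ∀ h1 h2, f z (cubesIn_subset Y hz) Jz = f (z ⊔ z') h1 h2 := by
    intro z z' hz Jz Jz' h1 h2
    refine up z hz Jz (Finset.univ.filter fun i => z i < z' i) ?_ _ ?_ _ _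
    · intro i hi
      have h3 := hJ i _ _ (Jz i) (Jz' i)
      have h4 : z i < z' i := by simpa using hi
      have : z i + 1 = z' i := by omega
      rw [this]; exact Jz' i
    · ext i
      have h3 := hJ i _ _ (Jz i) (Jz' i)
      by_cases hi : z i < z' i
      · simp only [Pi.sup_apply, Pi.add_apply, Finset.mem_filter, Finset.mem_univ, true_and,
          if_pos hi]
        rw [sup_eq_right.2 hi.le]; omega
      · simp only [Pi.sup_apply, Pi.add_apply, Finset.mem_filter, Finset.mem_univ, true_and,
          if_neg hi]
        rw [sup_eq_left.2 (not_lt.1 hi)]; omega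
  have hJs : ∀ i, J i ((z ⊔ z') i) := by
    intro i
    rcases le_total (z i) (z' i) with h | h
    · rw [Pi.sup_apply, sup_eq_right.2 h]; exact Jz' i
    · rw [Pi.sup_apply, sup_eq_left.2 h]; exact Jz i
  have hYs : z ⊔ z' ∈ Y := hz ⟨le_sup_left, fun i => by
    have h3 := hJ i _ _ (Jz i) (Jz' i)
    simp only [Pi.sup_apply, Pi.add_apply, Pi.one_apply]
    exact sup_le (by omega) h3⟩
  rw [main z z' hz Jz Jz' hYs hJs]
  have h := main z' z hz' Jz' Jz (by rw [sup_comm]; exact hYs) (by rw [sup_comm]; exact hJs)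
  rw [h]
  congr 1
  exact sup_comm _ _

theorem Face.inCube_close (F : Face D) (i : Fin D) (m n : ℤ)
    (hm : F.base i = m ∨ (i ∉ F.dirs ∧ F.base i = m + 1))
    (hn : F.base i = n ∨ (i ∉ F.dirs ∧ F.base i = n + 1)) : n ≤ m + 1 := by
  omega

theorem cube_close (p : Fin D → ℝ) (i : Fin D) (m n : ℤ)
    (hm : (m : ℝ) ≤ p i ∧ p i ≤ m + 1) (hn : (n : ℝ) ≤ p i ∧ p i ≤ n + 1) : n ≤ m + 1 := by
  have : (n : ℝ) ≤ m + 1 := hn.1.trans hm.2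
  exact_mod_cast this

theorem isClosed_unitCube (z : Lattice D) : IsClosed (unitCube z) := by
  have : unitCube z = Icc (fun i => (z i : ℝ)) (fun i => (z i : ℝ) + 1) := by
    ext p; simp [unitCube, Pi.le_def, forall_and]
  rw [this]; exact isClosed_Icc

theorem locallyFinite_unitCube : LocallyFinite (fun z : Lattice D => unitCube z) := by
  intro p
  refine ⟨Metric.ball p 1, Metric.ball_mem_nhds p one_pos, ?_⟩
  refine (Set.finite_Icc (fun i => ⌊p i⌋ - 3 : Lattice D) (fun i => ⌊p i⌋ + 3)).subset ?_
  rintro z ⟨x, hx, hxp⟩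
  have hd : ∀ i, |x i - p i| < 1 := fun i => by
    have := (dist_le_pi_dist x p i).trans_lt (Metric.mem_ball.1 hxp)
    rwa [Real.dist_eq] at this
  refine ⟨fun i => ?_, fun i => ?_⟩
  · have h1 := abs_lt.1 (hd i)
    have h2 := hx i
    have h3 := Int.floor_le (p i)
    have h5 : ((⌊p i⌋ : ℤ) : ℝ) - 3 ≤ z i := by linarith
    exact_mod_cast h5
  · have h1 := abs_lt.1 (hd i)
    have h2 := hx i
    have h4 := Int.lt_floor_add_one (p i)
    have h5 : (z i : ℝ) ≤ (⌊p i⌋ : ℤ) + 3 := by linarith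
    exact_mod_cast h5

end Geometry

/-! ### Cubical complexes over `ℝ^D`, their homology and cohomology -/

section Cubical

variable {D : ℕ}

/-- Combinatorial data of a cell complex whose cells are labelled copies of faces of the
canonical cell complex of `ℝ^D`. -/
structure CubicalComplex (D : ℕ) where
  /-- The cells of all dimensions. -/
  Cell : Type u
  /-- The face of `ℝ^D` over which a cell lies. -/
  face : Cell → Face D
  /-- The lower facet in direction `i`. -/
  lower : Fin D → Cell → Cell
  /-- The upper facet in direction `i`. -/
  upper : Fin D → Cell → Cell
  face_lower : ∀ i c, face (lower i c) = (face c).lower i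
  face_upper : ∀ i c, face (upper i c) = (face c).upper i

namespace CubicalComplex

variable (X : CubicalComplex.{u} D) (G : Type w) [AddCommGroup G]

/-- The dimension of a cell. -/
def dim (c : X.Cell) : ℕ := (X.face c).dirs.card

/-- The sign with which the upper facet in direction `i` occurs in the boundary of `c`. -/
def sign (c : X.Cell) (i : Fin D) : ℤ := (-1) ^ ((X.face c).dirs.filter (· < i)).card

/-- The cubical boundary operator on `G`-valued chains of all dimensions. -/
noncomputable def boundary : (X.Cell →₀ G) →+ (X.Cell →₀ G) :=
  Finsupp.liftAddHom fun c => ∑ i ∈ (X.face c).dirs,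
    X.sign c i • (Finsupp.singleAddHom (X.upper i c) - Finsupp.singleAddHom (X.lower i c))

/-- The cubical coboundary operator on `G`-valued cochains of all dimensions. -/
def coboundary : (X.Cell → G) →+ (X.Cell → G) where
  toFun η c := ∑ i ∈ (X.face c).dirs, X.sign c i • (η (X.upper i c) - η (X.lower i c))
  map_zero' := by ext c; simp
  map_add' η θ := by
    ext c
    simp only [Pi.add_apply, ← Finset.sum_add_distrib, ← smul_add]
    refine Finset.sum_congr rfl fun i _ => ?_
    congr 1; abel

/-- The `k`-chains. -/
def chains (k : ℕ) : AddSubgroup (X.Cell →₀ G) where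
  carrier := {x | ∀ c, X.dim c ≠ k → x c = 0}
  zero_mem' := by simp
  add_mem' {x y} hx hy c hc := by simp [hx c hc, hy c hc]
  neg_mem' {x} hx c hc := by simp [hx c hc]

/-- The `k`-cochains. -/
def cochains (k : ℕ) : AddSubgroup (X.Cell → G) where
  carrier := {x | ∀ c, X.dim c ≠ k → x c = 0}
  zero_mem' := by simp
  add_mem' {x y} hx hy c hc := by simp [hx c hc, hy c hc]
  neg_mem' {x} hx c hc := by simp [hx c hc]

/-- The `k`-cycles. -/
noncomputable def cycles (k : ℕ) : AddSubgroup (X.Cell →₀ G) :=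
  X.chains G k ⊓ (X.boundary G).ker

/-- The `k`-boundaries. -/
noncomputable def boundaries (k : ℕ) : AddSubgroup (X.Cell →₀ G) :=
  (X.chains G (k + 1)).map (X.boundary G)

/-- The `k`-cocycles. -/
def cocycles (k : ℕ) : AddSubgroup (X.Cell → G) :=
  X.cochains G k ⊓ (X.coboundary G).ker

/-- The `k`-coboundaries. -/
def coboundaries : ℕ → AddSubgroup (X.Cell → G)
  | 0 => ⊥
  | k + 1 => (X.cochains G k).map (X.coboundary G)

/-- The `k`-th homology group with coefficients in `G`. -/
abbrev Homology (k : ℕ) : Type _ :=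
  (X.cycles G k) ⧸ (X.boundaries G k).addSubgroupOf (X.cycles G k)

/-- The `k`-th cohomology group with coefficients in `G`. -/
abbrev Cohomology (k : ℕ) : Type _ :=
  (X.cocycles G k) ⧸ (X.coboundaries G k).addSubgroupOf (X.cocycles G k)

variable {X}

/-- A cellular map lying over the identity of `ℝ^D`. -/
structure Hom (X : CubicalComplex.{u} D) (Y : CubicalComplex.{v} D) where
  toFun : X.Cell → Y.Cell
  face_eq : ∀ c, Y.face (toFun c) = X.face c
  map_lower : ∀ i c, i ∈ (X.face c).dirs → toFun (X.lower i c) = Y.lower i (toFun c)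
  map_upper : ∀ i c, i ∈ (X.face c).dirs → toFun (X.upper i c) = Y.upper i (toFun c)

namespace Hom

variable {Y : CubicalComplex.{v} D}

theorem dim_eq (f : Hom X Y) (c : X.Cell) : Y.dim (f.toFun c) = X.dim c := by
  simp [CubicalComplex.dim, f.face_eq]

/-- The induced map on chains. -/
noncomputable def chainMap (f : Hom X Y) : (X.Cell →₀ G) →+ (Y.Cell →₀ G) :=
  Finsupp.mapDomain.addMonoidHom f.toFun

/-- The induced map on cochains. -/
def cochainMap (f : Hom X Y) : (Y.Cell → G) →+ (X.Cell → G) where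
  toFun η := η ∘ f.toFun
  map_zero' := rfl
  map_add' _ _ := rfl

theorem boundary_chainMap (f : Hom X Y) (x : X.Cell →₀ G) :
    Y.boundary G (f.chainMap G x) = f.chainMap G (X.boundary G x) := by
  have : (Y.boundary G).comp (f.chainMap G) = (f.chainMap G).comp (X.boundary G) := by
    refine Finsupp.addHom_ext fun c g => ?_
    simp only [AddMonoidHom.comp_apply, chainMap, boundary, Finsupp.mapDomain.addMonoidHom_apply,
      Finsupp.mapDomain_single, Finsupp.liftAddHom_apply_single, AddMonoidHom.finsetSum_apply,
      AddMonoidHom.smul_apply, AddMonoidHom.sub_apply, Finsupp.singleAddHom_apply, f.face_eq]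
    rw [Finsupp.mapDomain_finsetSum]
    refine Finset.sum_congr rfl fun i hi => ?_
    have hs : Y.sign (f.toFun c) i = X.sign c i := by
      simp [CubicalComplex.sign, f.face_eq]
    rw [hs, ← f.map_lower i c hi, ← f.map_upper i c hi]
    change _ = Finsupp.mapDomain.addMonoidHom f.toFun _
    rw [map_zsmul, map_sub]
    simp [Finsupp.mapDomain_single]
  exact DFunLike.congr_fun this x

theorem coboundary_cochainMap (f : Hom X Y) (η : Y.Cell → G) :
    X.coboundary G (f.cochainMap G η) = f.cochainMap G (Y.coboundary G η) := by
  ext c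
  simp only [coboundary, cochainMap, AddMonoidHom.coe_mk, ZeroHom.coe_mk, Function.comp_apply,
    f.face_eq]
  refine Finset.sum_congr rfl fun i hi => ?_
  have hs : Y.sign (f.toFun c) i = X.sign c i := by
    simp [CubicalComplex.sign, f.face_eq]
  rw [hs, f.map_lower i c hi, f.map_upper i c hi]

theorem chainMap_mem_chains (f : Hom X Y) {k : ℕ} {x : X.Cell →₀ G} (hx : x ∈ X.chains G k) :
    f.chainMap G x ∈ Y.chains G k := by
  classical
  intro c hc
  by_contra hne
  have h1 : c ∈ (Finsupp.mapDomain f.toFun x).support := Finsupp.mem_support_iff.2 hne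
  obtain ⟨c', hc', rfl⟩ := Finset.mem_image.1 (Finsupp.mapDomain_support h1)
  refine Finsupp.mem_support_iff.1 hc' (hx c' ?_)
  rwa [f.dim_eq] at hc

theorem cochainMap_mem_cochains (f : Hom X Y) {k : ℕ} {η : Y.Cell → G}
    (hη : η ∈ Y.cochains G k) : f.cochainMap G η ∈ X.cochains G k := by
  intro c hc
  exact hη _ (by rwa [f.dim_eq])

theorem chainMap_mem_cycles (f : Hom X Y) {k : ℕ} {x : X.Cell →₀ G} (hx : x ∈ X.cycles G k) :
    f.chainMap G x ∈ Y.cycles G k := by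
  refine ⟨f.chainMap_mem_chains G hx.1, ?_⟩
  have : X.boundary G x = 0 := hx.2
  change Y.boundary G (f.chainMap G x) = 0
  rw [boundary_chainMap, this, map_zero]

theorem cochainMap_mem_cocycles (f : Hom X Y) {k : ℕ} {η : Y.Cell → G}
    (hη : η ∈ Y.cocycles G k) : f.cochainMap G η ∈ X.cocycles G k := by
  refine ⟨f.cochainMap_mem_cochains G hη.1, ?_⟩
  have : Y.coboundary G η = 0 := hη.2
  change X.coboundary G (f.cochainMap G η) = 0
  rw [coboundary_cochainMap, this, map_zero]

theorem chainMap_mem_boundaries (f : Hom X Y) {k : ℕ} {x : X.Cell →₀ G}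
    (hx : x ∈ X.boundaries G k) : f.chainMap G x ∈ Y.boundaries G k := by
  obtain ⟨y, hy, rfl⟩ := hx
  exact ⟨f.chainMap G y, f.chainMap_mem_chains G hy, boundary_chainMap G f y⟩

theorem cochainMap_mem_coboundaries (f : Hom X Y) {k : ℕ} {η : Y.Cell → G}
    (hη : η ∈ Y.coboundaries G k) : f.cochainMap G η ∈ X.coboundaries G k := by
  cases k with
  | zero =>
    have : η = 0 := hη
    rw [this, map_zero]; exact AddSubgroup.zero_mem _
  | succ k =>
    obtain ⟨y, hy, rfl⟩ := hη
    exact ⟨f.cochainMap G y, f.cochainMap_mem_cochains G hy, coboundary_cochainMap G f y⟩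

/-- The induced map on cycles. -/
noncomputable def cyclesMap (f : Hom X Y) (k : ℕ) : X.cycles G k →+ Y.cycles G k :=
  ((f.chainMap G).comp (X.cycles G k).subtype).codRestrict _
    fun x => f.chainMap_mem_cycles G x.2

/-- The induced map on cocycles. -/
def cocyclesMap (f : Hom X Y) (k : ℕ) : Y.cocycles G k →+ X.cocycles G k :=
  ((f.cochainMap G).comp (Y.cocycles G k).subtype).codRestrict _
    fun x => f.cochainMap_mem_cocycles G x.2

/-- The induced map on homology. -/
noncomputable def homologyMap (f : Hom X Y) (k : ℕ) : X.Homology G k →+ Y.Homology G k :=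
  QuotientAddGroup.map _ _ (f.cyclesMap G k) fun _ hx => f.chainMap_mem_boundaries G hx

/-- The induced map on cohomology. -/
def cohomologyMap (f : Hom X Y) (k : ℕ) : Y.Cohomology G k →+ X.Cohomology G k :=
  QuotientAddGroup.map _ _ (f.cocyclesMap G k) fun _ hx => f.cochainMap_mem_coboundaries G hx

theorem homologyMap_square {X : CubicalComplex.{u} D} {Y : CubicalComplex.{v} D}
    {Y' : CubicalComplex.{v'} D} {Z : CubicalComplex.{w} D} {G : Type*} [AddCommGroup G]
    (f : Hom X Y) (g : Hom Y Z) (f' : Hom X Y') (g' : Hom Y' Z)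
    (h : ∀ c, g.toFun (f.toFun c) = g'.toFun (f'.toFun c)) (k : ℕ) (x : X.Homology G k) :
    g.homologyMap G k (f.homologyMap G k x) = g'.homologyMap G k (f'.homologyMap G k x) := by
  induction x using QuotientAddGroup.induction_on with
  | H x =>
    refine congrArg (QuotientAddGroup.mk (s := (Z.boundaries G k).addSubgroupOf (Z.cycles G k)))
      (Subtype.ext ?_)
    change Finsupp.mapDomain g.toFun (Finsupp.mapDomain f.toFun x.1)
      = Finsupp.mapDomain g'.toFun (Finsupp.mapDomain f'.toFun x.1)
    rw [← Finsupp.mapDomain_comp, ← Finsupp.mapDomain_comp]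
    congr 1
    exact funext h

theorem cohomologyMap_square {X : CubicalComplex.{u} D} {Y : CubicalComplex.{v} D}
    {Y' : CubicalComplex.{v'} D} {Z : CubicalComplex.{w} D} {G : Type*} [AddCommGroup G]
    (f : Hom X Y) (g : Hom Y Z) (f' : Hom X Y') (g' : Hom Y' Z)
    (h : ∀ c, g.toFun (f.toFun c) = g'.toFun (f'.toFun c)) (k : ℕ) (x : Z.Cohomology G k) :
    f.cohomologyMap G k (g.cohomologyMap G k x) =
      f'.cohomologyMap G k (g'.cohomologyMap G k x) := by
  induction x using QuotientAddGroup.induction_on with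
  | H x =>
    refine congrArg
      (QuotientAddGroup.mk (s := (X.coboundaries G k).addSubgroupOf (X.cocycles G k)))
      (Subtype.ext ?_)
    exact funext fun c => congrArg x.1 (h c)

end Hom

end CubicalComplex

/-- The subcomplex of `ℝ^D` formed by the unit cubes all of whose corners lie in `Y`, that is, the
canonical cell structure of `thicken Y`. -/
def regionComplex (Y : Set (Lattice D)) : CubicalComplex.{0} D where
  Cell := {F : Face D // ∃ z ∈ cubesIn Y, F.InCube z}
  face c := c.1
  lower i c := ⟨c.1.lower i, c.2.imp fun _ h => ⟨h.1, h.2.lower i⟩⟩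
  upper i c := ⟨c.1.upper i, c.2.imp fun _ h => ⟨h.1, h.2.upper i⟩⟩
  face_lower _ _ := rfl
  face_upper _ _ := rfl

/-- The inclusion of subcomplexes of `ℝ^D`. -/
def regionIncl {Y Y' : Set (Lattice D)} (h : Y ⊆ Y') :
    CubicalComplex.Hom (regionComplex Y) (regionComplex Y') where
  toFun c := ⟨c.1, c.2.imp fun _ hz => ⟨cubesIn_mono h hz.1, hz.2⟩⟩
  face_eq _ := rfl
  map_lower _ _ _ := rfl
  map_upper _ _ _ := rfl

end Cubical

/-! ### The tile complexes `X_r` -/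

section Tiles

variable {D : ℕ} {A : Type u} {S : Set (Config D A)}

/-- The face-matching rule of the radius `r` Wang representation in direction `d`: the top face of
`b` agrees with the bottom face of `b'`. -/
def EdgeMatch (d : Fin D) {r : ℕ} (b b' : Block D A r) : Prop :=
  ∀ (x : Lattice D) (h : x ∈ box D r) (h' : x + unitVec d ∈ box D r),
    b ⟨x + unitVec d, h'⟩ = b' ⟨x, h⟩

/-- A labelled unit cube: a position together with an admissible `r`-block. -/
abbrev Tile (S : Set (Config D A)) (r : ℕ) := Lattice D × Adm S r

/-- `t'` is the neighbour of `t` in direction `d` and the two labels match. -/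
def Glued {r : ℕ} (d : Fin D) (t t' : Tile S r) : Prop :=
  t'.1 = t.1 + unitVec d ∧ EdgeMatch d t.2.1 t'.2.1

/-- The gluing of points of labelled unit cubes along matching faces. -/
def PointGlue {r : ℕ} (x y : Σ t : Tile S r, unitCube t.1) : Prop :=
  (∃ d, Glued d x.1 y.1) ∧ x.2.1 = y.2.1

/-- The tile complex `X_r` as a topological space: the disjoint union of all labelled unit cubes,
modulo gluing of matching faces. -/
def TileSpace (S : Set (Config D A)) (r : ℕ) : Type u := Quot (PointGlue (S := S) (r := r))

instance (S : Set (Config D A)) (r : ℕ) : TopologicalSpace (TileSpace S r) :=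
  inferInstanceAs (TopologicalSpace (Quot _))

/-- The gluing of faces of labelled unit cubes along matching facets. -/
def FaceGlue {r : ℕ} (x y : {x : Tile S r × Face D // x.2.InCube x.1.1}) : Prop :=
  (∃ d, Glued d x.1.1 y.1.1) ∧ x.1.2 = y.1.2

/-- The cell structure of the tile complex `X_r`. -/
def tileComplex (S : Set (Config D A)) (r : ℕ) : CubicalComplex.{u} D where
  Cell := Quot (FaceGlue (S := S) (r := r))
  face := Quot.lift (fun x => x.1.2) fun _ _ h => h.2
  lower i := Quot.map (fun x => ⟨(x.1.1, x.1.2.lower i), x.2.lower i⟩)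
    fun _ _ h => ⟨h.1, congrArg (Face.lower i) h.2⟩
  upper i := Quot.map (fun x => ⟨(x.1.1, x.1.2.upper i), x.2.upper i⟩)
    fun _ _ h => ⟨h.1, congrArg (Face.upper i) h.2⟩
  face_lower i c := by induction c using Quot.ind; rfl
  face_upper i c := by induction c using Quot.ind; rfl

/-- A map of labels which respects the matching rules. -/
structure BlockMap (S : Set (Config D A)) (r s : ℕ) where
  toFun : Adm S r → Adm S s
  map_match : ∀ d b b', EdgeMatch d b.1 b'.1 → EdgeMatch d (toFun b).1 (toFun b').1

namespace BlockMap

variable {r s : ℕ}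

/-- The cellular map of tile complexes which changes the labels of cubes. -/
def spaceMap (g : BlockMap S r s) : C(TileSpace S r, TileSpace S s) where
  toFun := Quot.map (fun x => ⟨(x.1.1, g.toFun x.1.2), x.2⟩)
    fun _ _ h => ⟨h.1.imp fun d hd => ⟨hd.1, g.map_match d _ _ hd.2⟩, h.2⟩
  continuous_toFun := by
    refine continuous_quot_lift _ (continuous_quot_mk.comp ?_)
    exact continuous_sigma fun t => (continuous_sigmaMk :
      Continuous (Sigma.mk (β := fun t : Tile S s => unitCube t.1) (t.1, g.toFun t.2)))

/-- The same map on cells. -/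
def cellMap (g : BlockMap S r s) : CubicalComplex.Hom (tileComplex S r) (tileComplex S s) where
  toFun := Quot.map (fun x => ⟨((x.1.1.1, g.toFun x.1.1.2), x.1.2), x.2⟩)
    fun _ _ h => ⟨h.1.imp fun d hd => ⟨hd.1, g.map_match d _ _ hd.2⟩, h.2⟩
  face_eq c := by induction c using Quot.ind; rfl
  map_lower i c _ := by induction c using Quot.ind; rfl
  map_upper i c _ := by induction c using Quot.ind; rfl

theorem spaceMap_square {r s s' t : ℕ} (g : BlockMap S r s) (h : BlockMap S s t)
    (g' : BlockMap S r s') (h' : BlockMap S s' t)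
    (e : ∀ b, h.toFun (g.toFun b) = h'.toFun (g'.toFun b)) (x : TileSpace S r) :
    h.spaceMap (g.spaceMap x) = h'.spaceMap (g'.spaceMap x) := by
  induction x using Quot.ind with
  | mk x =>
    obtain ⟨⟨z, b⟩, p⟩ := x
    change Quot.mk _ (⟨(z, h.toFun (g.toFun b)), p⟩ : Σ t : Tile S t, unitCube t.1)
      = Quot.mk _ ⟨(z, h'.toFun (g'.toFun b)), p⟩
    rw [e]

theorem cellMap_square {r s s' t : ℕ} (g : BlockMap S r s) (h : BlockMap S s t)
    (g' : BlockMap S r s') (h' : BlockMap S s' t)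
    (e : ∀ b, h.toFun (g.toFun b) = h'.toFun (g'.toFun b)) (x : (tileComplex S r).Cell) :
    h.cellMap.toFun (g.cellMap.toFun x) = h'.cellMap.toFun (g'.cellMap.toFun x) := by
  induction x using Quot.ind with
  | mk x =>
    obtain ⟨⟨⟨z, b⟩, F⟩, hF⟩ := x
    change Quot.mk _ (⟨((z, h.toFun (g.toFun b)), F), hF⟩ :
        {x : Tile S t × Face D // x.2.InCube x.1.1})
      = Quot.mk _ ⟨((z, h'.toFun (g'.toFun b)), F), hF⟩
    rw [e]

end BlockMap

/-- The map of labels inducing `ζ : X_s → X_r`, for `r ≤ s`. -/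
def restrictMap (S : Set (Config D A)) {r s : ℕ} (h : r ≤ s) : BlockMap S s r where
  toFun b := ⟨Block.restrict h b.1, Adm.restrict h b.2⟩
  map_match _ _ _ hb x hx hx' := hb x (box_mono h hx) (box_mono h hx')

theorem box_add {r q : ℕ} {x y : Lattice D} (hx : x ∈ box D r) (hy : y ∈ box D q) :
    x + y ∈ box D (r + q) := fun i => by
  have h1 := abs_le.1 (hx i)
  have h2 := abs_le.1 (hy i)
  rw [Pi.add_apply, abs_le]
  push_cast
  constructor <;> linarith

/-- The map of labels inducing `Φ_* : X_(r+q) → X_r`: an admissible block of radius `r + q` is sent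
to the central block of radius `r` of its image under `Φ`. -/
noncomputable def caMap {Φ : Config D A → Config D A} {q : ℕ} (hq : HasRadius Φ q)
    (hS : MapsTo Φ S S) (r : ℕ) : BlockMap S (r + q) r where
  toFun b := ⟨blockAt (Φ b.2.choose) r 0, Φ b.2.choose, hS b.2.choose_spec.1, rfl⟩
  map_match d b b' hb x hx hx' := by
    have e1 := b.2.choose_spec.2
    have e2 := b'.2.choose_spec.2
    refine hq _ _ _ _ fun y hy => ?_
    have h1 := congrFun e1 ⟨x + unitVec d + y, box_add hx' hy⟩
    have h2 := congrFun e2 ⟨x + y, box_add hx hy⟩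
    have e3 : x + y + unitVec d = x + unitVec d + y := by abel
    have h3 := hb (x + y) (box_add hx hy) (by rw [e3]; exact box_add hx' hy)
    simp only [blockAt] at h1 h2
    have h4 : b.1 ⟨x + unitVec d + y, box_add hx' hy⟩
        = b.1 ⟨x + y + unitVec d, by rw [e3]; exact box_add hx' hy⟩ :=
      congrArg b.1 (Subtype.ext e3.symm)
    rw [add_assoc 0, h1, add_assoc 0, h2, h4, h3]

theorem caMap_blockAt {Φ : Config D A → Config D A} {q : ℕ} (hq : HasRadius Φ q)
    (hS : MapsTo Φ S S) (r : ℕ) {c : Config D A} (hc : c ∈ S) :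
    (caMap hq hS r).toFun ⟨blockAt c (r + q) 0, c, hc, rfl⟩
      = ⟨blockAt (Φ c) r 0, Φ c, hS hc, rfl⟩ := by
  refine Subtype.ext (funext fun x => ?_)
  have hb : blockAt c (r + q) 0 ∈ Adm S (r + q) := ⟨c, hc, rfl⟩
  have e1 : blockAt hb.choose (r + q) 0 = blockAt c (r + q) 0 := hb.choose_spec.2
  refine hq _ _ _ _ fun y hy => ?_
  have h1 := congrFun e1 ⟨x + y, box_add x.2 hy⟩
  simpa [blockAt, add_assoc] using h1

/-- The maps induced by `Φ` commute with the restriction maps. -/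
theorem caMap_restrict {Φ : Config D A → Config D A} {q : ℕ} (hq : HasRadius Φ q)
    (hS : MapsTo Φ S S) {r s : ℕ} (h : r ≤ s) (b : Adm S (s + q)) :
    (restrictMap S h).toFun ((caMap hq hS s).toFun b)
      = (caMap hq hS r).toFun ((restrictMap S (Nat.add_le_add_right h q)).toFun b) := by
  obtain ⟨_, c, hc, rfl⟩ := b
  have e1 := caMap_blockAt hq hS s hc
  have e2 := caMap_blockAt hq hS r hc
  change _ = (caMap hq hS r).toFun ⟨blockAt c (r + q) 0, c, hc, rfl⟩
  rw [e2]
  change (restrictMap S h).toFun ((caMap hq hS s).toFun ⟨blockAt c (s + q) 0, c, hc, rfl⟩) = _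
  rw [e1]
  rfl

/-- The base vertex `x_r(c)` of `X_r`: the corner over `0` of the cube at `0` labelled by the
central `r`-block of `c`. -/
def basePt (c : S) (r : ℕ) : TileSpace S r :=
  Quot.mk _ ⟨(0, ⟨blockAt c.1 r 0, c.1, c.2, rfl⟩), ⟨0, fun i => by simp⟩⟩

theorem restrict_basePt (c : S) {r s : ℕ} (h : r ≤ s) :
    (restrictMap S h).spaceMap (basePt c s) = basePt c r := rfl

theorem caMap_basePt {Φ : Config D A → Config D A} {q : ℕ} (hq : HasRadius Φ q)
    (hS : MapsTo Φ S S) (c : S) (r : ℕ) :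
    (caMap hq hS r).spaceMap (basePt c (r + q)) = basePt ⟨Φ c.1, hS c.2⟩ r := by
  have e := caMap_blockAt hq hS r c.2
  change Quot.mk _ (⟨(0, (caMap hq hS r).toFun ⟨blockAt c.1 (r + q) 0, c.1, c.2, rfl⟩), _⟩ :
    Σ t : Tile S r, unitCube t.1) = _
  rw [e]
  rfl

/-! ### The sections determined by a configuration -/

/-- The label which `a` gives to the cube at `z`. -/
def tileAt (a : Config D A) (r : ℕ) (z : Lattice D) (hz : z ∈ unflawed S a r) : Tile S r :=
  (z, ⟨blockAt a r z, hz⟩)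

theorem glued_tileAt (a : Config D A) (r : ℕ) (z : Lattice D) (d : Fin D)
    (hz : z ∈ unflawed S a r) (hz' : z + unitVec d ∈ unflawed S a r) :
    Glued d (tileAt a r z hz) (tileAt a r (z + unitVec d) hz') := by
  refine ⟨rfl, fun x _ _ => ?_⟩
  change a (z + (x + unitVec d)) = a (z + unitVec d + x)
  congr 1; abel

/-- The value at `p` of the section of `X_r → ℝ^D` determined by `a`, computed in the cube
at `z`. -/
def sectionAt (a : Config D A) (r : ℕ) (p : Fin D → ℝ) (z : Lattice D)
    (hz : z ∈ unflawed S a r) (hp : p ∈ unitCube z) : TileSpace S r :=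
  Quot.mk _ ⟨tileAt a r z hz, ⟨p, hp⟩⟩

theorem sectionAt_eq (a : Config D A) (r : ℕ) (p : Fin D → ℝ) {z z' : Lattice D}
    (hz : z ∈ cubesIn (unflawed S a r)) (hz' : z' ∈ cubesIn (unflawed S a r))
    (hp : p ∈ unitCube z) (hp' : p ∈ unitCube z') :
    sectionAt a r p z (cubesIn_subset _ hz) hp = sectionAt a r p z' (cubesIn_subset _ hz') hp' :=
  chain_eq (cube_close p) (sectionAt a r p)
    (fun w d h1 _ h3 _ => Quot.sound ⟨⟨d, glued_tileAt a r w d h1 h3⟩, rfl⟩) hz hz' hp hp'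

/-- The section over the unflawed region determined by `a`, as a map of spaces. -/
noncomputable def sectionMap (S : Set (Config D A)) (a : Config D A) (r : ℕ) :
    C(thicken (unflawed S a r), TileSpace S r) where
  toFun p := sectionAt a r p.1 p.2.choose (cubesIn_subset _ p.2.choose_spec.1) p.2.choose_spec.2
  continuous_toFun := by
    have hlf : LocallyFinite fun z : cubesIn (unflawed S a r) =>
        ((fun p : thicken (unflawed S a r) => p.1) ⁻¹' unitCube z.1) :=
      (locallyFinite_unitCube.preimage_continuous continuous_subtype_val).comp_injective
        Subtype.val_injective
    refine hlf.continuous ?_ (fun z => (isClosed_unitCube z.1).preimage continuous_subtype_val) ?_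
    · refine eq_univ_of_forall fun p => ?_
      obtain ⟨z, hz, hp⟩ := p.2
      exact mem_iUnion.2 ⟨⟨z, hz⟩, hp⟩
    · intro z
      rw [continuousOn_iff_continuous_domRestrict]
      have hc : Continuous fun p : ((fun p : thicken (unflawed S a r) => p.1) ⁻¹' unitCube z.1) =>
          sectionAt a r p.1.1 z.1 (cubesIn_subset _ z.2) p.2 :=
        continuous_quot_mk.comp (continuous_sigmaMk.comp
          (Continuous.subtype_mk (continuous_subtype_val.comp continuous_subtype_val) _))
      convert hc using 1
      ext p
      exact sectionAt_eq a r p.1.1 p.1.2.choose_spec.1 z.2 p.1.2.choose_spec.2 p.2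

theorem sectionMap_apply (a : Config D A) (r : ℕ) (p : thicken (unflawed S a r)) {z : Lattice D}
    (hz : z ∈ cubesIn (unflawed S a r)) (hp : p.1 ∈ unitCube z) :
    sectionMap S a r p = sectionAt a r p.1 z (cubesIn_subset _ hz) hp :=
  sectionAt_eq a r p.1 p.2.choose_spec.1 hz p.2.choose_spec.2 hp

/-- The sections for different radii are compatible. -/
theorem restrict_sectionMap (a : Config D A) {r s : ℕ} (h : r ≤ s)
    (p : thicken (unflawed S a s)) :
    (restrictMap S h).spaceMap (sectionMap S a s p)
      = sectionMap S a r ⟨p.1, thicken_mono (unflawed_anti S a h) p.2⟩ := by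
  obtain ⟨z, hz, hp⟩ := p.2
  rw [sectionMap_apply a s p hz hp,
    sectionMap_apply a r _ (cubesIn_mono (unflawed_anti S a h) hz) hp]
  rfl

/-- The value at the face `F` of the section of `X_r → ℝ^D` determined by `a`, computed in the
cube at `z`. -/
def cellAt (a : Config D A) (r : ℕ) (F : Face D) (z : Lattice D)
    (hz : z ∈ unflawed S a r) (hF : F.InCube z) : (tileComplex S r).Cell :=
  Quot.mk _ ⟨(tileAt a r z hz, F), hF⟩

theorem cellAt_eq (a : Config D A) (r : ℕ) (F : Face D) {z z' : Lattice D}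
    (hz : z ∈ cubesIn (unflawed S a r)) (hz' : z' ∈ cubesIn (unflawed S a r))
    (hF : F.InCube z) (hF' : F.InCube z') :
    cellAt a r F z (cubesIn_subset _ hz) hF = cellAt a r F z' (cubesIn_subset _ hz') hF' :=
  chain_eq F.inCube_close (cellAt a r F)
    (fun w d h1 _ h3 _ => Quot.sound ⟨⟨d, glued_tileAt a r w d h1 h3⟩, rfl⟩) hz hz' hF hF'

/-- The section over the unflawed region determined by `a`, as a map of cells. -/
noncomputable def sectionHom (S : Set (Config D A)) (a : Config D A) (r : ℕ) :
    CubicalComplex.Hom (regionComplex (unflawed S a r)) (tileComplex S r) where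
  toFun c := cellAt a r c.1 c.2.choose (cubesIn_subset _ c.2.choose_spec.1) c.2.choose_spec.2
  face_eq _ := rfl
  map_lower i c _ := cellAt_eq a r (c.1.lower i)
    ((regionComplex (unflawed S a r)).lower i c).2.choose_spec.1 c.2.choose_spec.1
    ((regionComplex (unflawed S a r)).lower i c).2.choose_spec.2 (c.2.choose_spec.2.lower i)
  map_upper i c _ := cellAt_eq a r (c.1.upper i)
    ((regionComplex (unflawed S a r)).upper i c).2.choose_spec.1 c.2.choose_spec.1
    ((regionComplex (unflawed S a r)).upper i c).2.choose_spec.2 (c.2.choose_spec.2.upper i)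

theorem restrict_sectionHom (a : Config D A) {r s : ℕ} (h : r ≤ s)
    (c : (regionComplex (unflawed S a s)).Cell) :
    (restrictMap S h).cellMap.toFun ((sectionHom S a s).toFun c)
      = (sectionHom S a r).toFun ((regionIncl (unflawed_anti S a h)).toFun c) :=
  cellAt_eq a r c.1 (cubesIn_mono (unflawed_anti S a h) c.2.choose_spec.1)
    ((regionIncl (unflawed_anti S a h)).toFun c).2.choose_spec.1 c.2.choose_spec.2
    ((regionIncl (unflawed_anti S a h)).toFun c).2.choose_spec.2

end Tiles

/-! ### Homotopy groups -/

section Homotopy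

variable {X : Type u} [TopologicalSpace X] {Y : Type v} [TopologicalSpace Y]
  {Z : Type w} [TopologicalSpace Z] {k : ℕ}

/-- Composition of a `k`-dimensional loop with a pointed continuous map. -/
def mapLoop (f : C(X, Y)) {x : X} {y : Y} (h : f x = y) (g : GenLoop (Fin k) X x) :
    GenLoop (Fin k) Y y :=
  ⟨f.comp g.1, fun p hp => by
    change f (g p) = y
    rw [GenLoop.boundary g p hp, h]⟩

/-- The map induced on `k`-th homotopy groups by a pointed continuous map. -/
def piMap (f : C(X, Y)) {x : X} {y : Y} (h : f x = y) :
    HomotopyGroup (Fin k) X x → HomotopyGroup (Fin k) Y y :=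
  Quotient.map (mapLoop f h) fun _ _ hg => hg.comp_continuousMap f

theorem piMap_square {Y' : Type v} [TopologicalSpace Y'] {x : X} {y : Y} {y' : Y'} {z : Z}
    (f : C(X, Y)) (g : C(Y, Z)) (f' : C(X, Y')) (g' : C(Y', Z))
    (hf : f x = y) (hg : g y = z) (hf' : f' x = y') (hg' : g' y' = z)
    (e : ∀ x, g (f x) = g' (f' x)) (a : HomotopyGroup (Fin k) X x) :
    piMap g hg (piMap f hf a) = piMap g' hg' (piMap f' hf' a) := by
  induction a using Quotient.inductionOn with
  | h a =>
    exact congrArg (Quotient.mk _) (GenLoop.ext _ _ fun p => e (a p))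

/-- A base ray in `Y`, defined on a final segment of `[0,∞)`. -/
structure Ray (Y : Type v) [TopologicalSpace Y] where
  dom : Set ℝ≥0
  upper : IsUpperSet dom
  pt : dom → Y
  continuous_pt : Continuous pt

/-- The image of a base ray. -/
def Ray.map (f : C(X, Y)) (ρ : Ray X) : Ray Y :=
  ⟨ρ.dom, ρ.upper, f ∘ ρ.pt, f.continuous.comp ρ.continuous_pt⟩

/-- A `k`-dimensional loop based at `ρ(t)` and one based at `ρ(t')` are identified when the second
is the transport of the first along the segment of `ρ` from `t` to `t'`: there is a homotopy
between them which moves the base point along that segment. -/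
def RayRel (k : ℕ) (ρ : Ray Y) (x y : Σ t : ρ.dom, GenLoop (Fin k) Y (ρ.pt t)) : Prop :=
  ∃ H : C(I × (Fin k → I), Y), (∀ p, H (0, p) = x.2 p) ∧ (∀ p, H (1, p) = y.2 p) ∧
    ∀ (s : I), ∀ p ∈ Cube.boundary (Fin k), ∀ t : ρ.dom,
      ((t : ℝ≥0) : ℝ) = (1 - (s : ℝ)) * (x.1 : ℝ≥0) + (s : ℝ) * (y.1 : ℝ≥0) → H (s, p) = ρ.pt t

/-- The homotopy group `π_k(Y, ρ)` based along the ray `ρ` (as a set): it is `π_k(Y, ρ(t))` for any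
`t`, these being identified with each other along segments of `ρ`. -/
def RayPi (k : ℕ) (Y : Type v) [TopologicalSpace Y] (ρ : Ray Y) : Type v := Quot (RayRel k ρ)

/-- The neutral element of `π_k(Y, ρ)`. -/
def RayPi.IsOne {ρ : Ray Y} (u : RayPi k Y ρ) : Prop :=
  ∃ t : ρ.dom, u = Quot.mk _ ⟨t, GenLoop.const⟩

/-- The map induced on homotopy groups based along rays by a continuous map that carries one ray
to (a final segment of) the other. -/
def RayPi.map (f : C(X, Y)) {ρ : Ray X} {ρ' : Ray Y} (hd : ρ.dom ⊆ ρ'.dom)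
    (hp : ∀ t : ρ.dom, f (ρ.pt t) = ρ'.pt ⟨t.1, hd t.2⟩) : RayPi k X ρ → RayPi k Y ρ' :=
  Quot.map (fun x => ⟨⟨x.1.1, hd x.1.2⟩, mapLoop f (hp x.1) x.2⟩) (by
    rintro x y ⟨H, h0, h1, hb⟩
    refine ⟨f.comp H, fun p => congrArg f (h0 p), fun p => congrArg f (h1 p),
      fun s p hpb t ht => ?_⟩
    have htd : t.1 ∈ ρ.dom := by
      rcases le_total x.1.1 y.1.1 with hxy | hxy
      · refine ρ.upper ?_ x.1.2
        have hxy' : ((x.1.1 : ℝ≥0) : ℝ) ≤ y.1.1 := by exact_mod_cast hxy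
        have : ((x.1.1 : ℝ≥0) : ℝ) ≤ (t.1 : ℝ≥0) := by
          rw [ht]; nlinarith [s.2.1, s.2.2, mul_nonneg s.2.1 (sub_nonneg.2 hxy')]
        exact_mod_cast this
      · refine ρ.upper ?_ y.1.2
        have hxy' : ((y.1.1 : ℝ≥0) : ℝ) ≤ x.1.1 := by exact_mod_cast hxy
        have : ((y.1.1 : ℝ≥0) : ℝ) ≤ (t.1 : ℝ≥0) := by
          rw [ht]
          nlinarith [s.2.1, s.2.2, mul_nonneg (sub_nonneg.2 s.2.2) (sub_nonneg.2 hxy')]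
        exact_mod_cast this
    have := hb s p hpb ⟨t.1, htd⟩ ht
    change f (H (s, p)) = _
    rw [this]
    exact hp ⟨t.1, htd⟩)

theorem RayPi.map_square {Y' : Type*} [TopologicalSpace Y'] (f : C(X, Y)) (g : C(Y, Z))
    (f' : C(X, Y')) (g' : C(Y', Z)) {ρX : Ray X} {ρY : Ray Y} {ρY' : Ray Y'} {ρZ : Ray Z}
    (h1 : ρX.dom ⊆ ρY.dom) (p1 : ∀ t : ρX.dom, f (ρX.pt t) = ρY.pt ⟨t.1, h1 t.2⟩)
    (h2 : ρY.dom ⊆ ρZ.dom) (p2 : ∀ t : ρY.dom, g (ρY.pt t) = ρZ.pt ⟨t.1, h2 t.2⟩)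
    (h3 : ρX.dom ⊆ ρY'.dom) (p3 : ∀ t : ρX.dom, f' (ρX.pt t) = ρY'.pt ⟨t.1, h3 t.2⟩)
    (h4 : ρY'.dom ⊆ ρZ.dom) (p4 : ∀ t : ρY'.dom, g' (ρY'.pt t) = ρZ.pt ⟨t.1, h4 t.2⟩)
    (e : ∀ x, g (f x) = g' (f' x)) (a : RayPi k X ρX) :
    RayPi.map g h2 p2 (RayPi.map f h1 p1 a) = RayPi.map g' h4 p4 (RayPi.map f' h3 p3 a) := by
  induction a using Quot.ind with
  | mk a =>
    refine congrArg (Quot.mk _) ?_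
    refine congrArg (Sigma.mk _) ?_
    exact GenLoop.ext _ _ fun p => e (a.2 p)

/-- The inverse limit of a sequence of sets. -/
def InvLim (P : ℕ → Type u) (f : ∀ r s, r ≤ s → P s → P r) : Type u :=
  {p : ∀ r, P r // ∀ r s h, f r s h (p s) = p r}

/-- The inverse limit of a sequence of abelian groups. -/
def invLimGroup (P : ℕ → Type u) [∀ r, AddCommGroup (P r)] (f : ∀ r s, r ≤ s → P s →+ P r) :
    AddSubgroup (∀ r, P r) where
  carrier := {p | ∀ r s h, f r s h (p s) = p r}
  zero_mem' r s h := by simp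
  add_mem' {x y} hx hy r s h := by simp [hx r s h, hy r s h]
  neg_mem' {x} hx r s h := by simp [hx r s h]

end Homotopy

/-! ### Projective homotopy groups and homotopy defects -/

section ProjectiveHomotopy

variable {D : ℕ} {A : Type u} {S : Set (Config D A)}

/-- The projective homotopy group `π_k(S, c)` (as a set): the inverse limit of the groups
`π_k(X_r, x_r(c))`. -/
def ProjPi (k : ℕ) (c : S) : Type u :=
  InvLim (fun r => HomotopyGroup (Fin k) (TileSpace S r) (basePt c r))
    fun _ _ h => piMap (restrictMap S h).spaceMap (restrict_basePt c h)

/-- The map `π_k Φ : π_k(S, c) → π_k(S, Φ(c))`. -/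
noncomputable def projPiMap {Φ : Config D A → Config D A} {q : ℕ} (hq : HasRadius Φ q)
    (hS : MapsTo Φ S S) (k : ℕ) (c : S) (u : ProjPi k c) : ProjPi k (⟨Φ c.1, hS c.2⟩ : S) :=
  ⟨fun r => piMap (caMap hq hS r).spaceMap (caMap_basePt hq hS c r) (u.1 (r + q)),
    fun r _ h =>
      (piMap_square _ _ _ (caMap hq hS r).spaceMap _ _ (restrict_basePt c _) _
        (BlockMap.spaceMap_square _ _ _ _ (caMap_restrict hq hS h)) _).trans
      (congrArg _ (u.2 _ _ (Nat.add_le_add_right h q)))⟩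

/-- The projection from the vertices of `X_r` to `ℤ^D` is injective. -/
def VertexInjective (S : Set (Config D A)) (r : ℕ) : Prop :=
  ∀ c c' : (tileComplex S r).Cell, (tileComplex S r).dim c = 0 → (tileComplex S r).dim c' = 0 →
    (tileComplex S r).face c = (tileComplex S r).face c' → c = c'

/-- The map `π_1(X_s, x_s(c)) → π_1(X_r, x_r(c))`, for `r ≤ s`. -/
noncomputable def piOneMap (c : S) {r s : ℕ} (h : r ≤ s) :
    FundamentalGroup (TileSpace S s) (basePt c s) →*
      FundamentalGroup (TileSpace S r) (basePt c r) :=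
  FundamentalGroup.mapOfEq (restrictMap S h).spaceMap (restrict_basePt c h)

/-- `S` is basepoint-free in codimension `k + 1`: the vertices of `X_r` are determined by their
positions for all large `r`, or `S` is weakly mixing and the tower of fundamental groups
`π_1(X_r, x_r(c))` is abelian (when `k = 1`) or trivial (for any `k`) as a pro-group. -/
def IsBasepointFree [TopologicalSpace A] (S : Set (Config D A)) (k : ℕ) : Prop :=
  (∃ r₀, ∀ r, r₀ ≤ r → VertexInjective S r) ∨
  (IsWeaklyMixing S ∧ k = 1 ∧ ∃ c : S, ∀ r, ∃ s, ∃ h : r ≤ s,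
    ∀ u v, piOneMap c h u * piOneMap c h v = piOneMap c h v * piOneMap c h u) ∨
  (IsWeaklyMixing S ∧ ∃ c : S, ∀ r, ∃ s, ∃ h : r ≤ s, ∀ u, piOneMap c h u = 1)

/-- A proper base ray for `a`: a path to infinity which for each `r` eventually stays in the
(thickened) region `G_r(a)`. -/
structure ProperBaseRay (S : Set (Config D A)) (a : Config D A) where
  toFun : ℝ≥0 → Fin D → ℝ
  continuous_toFun : Continuous toFun
  tendsto_norm : Tendsto (fun t => ‖toFun t‖) atTop atTop
  eventually_mem : ∀ r, ∀ᶠ t in atTop, toFun t ∈ thicken (unflawed S a r)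

/-- The final segment of a proper base ray which stays in `G_r(a)`. -/
def ProperBaseRay.rayAt {a : Config D A} (ω : ProperBaseRay S a) (r : ℕ) :
    Ray (thicken (unflawed S a r)) where
  dom := {t | ∀ t', t ≤ t' → ω.toFun t' ∈ thicken (unflawed S a r)}
  upper _ _ h ht t' ht' := ht t' (h.trans ht')
  pt t := ⟨ω.toFun t.1, t.2 t.1 le_rfl⟩
  continuous_pt := (ω.continuous_toFun.comp continuous_subtype_val).subtype_mk _

theorem ProperBaseRay.rayAt_dom {a : Config D A} (ω : ProperBaseRay S a) {r s : ℕ} (h : r ≤ s) :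
    (ω.rayAt s).dom ⊆ (ω.rayAt r).dom :=
  fun _ ht t' ht' => thicken_mono (unflawed_anti S a h) (ht t' ht')

/-- The inclusion of `G_s(a)` into `G_r(a)`, for `r ≤ s`. -/
def regionMap (S : Set (Config D A)) (a : Config D A) {r s : ℕ} (h : r ≤ s) :
    C(thicken (unflawed S a s), thicken (unflawed S a r)) :=
  ⟨fun p => ⟨p.1, thicken_mono (unflawed_anti S a h) p.2⟩, by fun_prop⟩

/-- The group `π_k(G_∞(a), ω)` (as a set): the inverse limit of the groups `π_k(G_r(a), ω)`. -/
def RegionPi (k : ℕ) {a : Config D A} (ω : ProperBaseRay S a) : Type :=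
  InvLim (fun r => RayPi k (thicken (unflawed S a r)) (ω.rayAt r))
    fun _ _ h => RayPi.map (regionMap S a h) (ω.rayAt_dom h) fun _ => rfl

/-- The image in `X_r` of (a final segment of) `ω` under the section determined by `a`. -/
noncomputable def ProperBaseRay.sectionRay {a : Config D A} (ω : ProperBaseRay S a) (r : ℕ) :
    Ray (TileSpace S r) :=
  (ω.rayAt r).map (sectionMap S a r)

theorem ProperBaseRay.sectionRay_dom {a : Config D A} (ω : ProperBaseRay S a) {r s : ℕ}
    (h : r ≤ s) : (ω.sectionRay s).dom ⊆ (ω.sectionRay r).dom :=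
  ω.rayAt_dom h

theorem ProperBaseRay.rayAt_dom_subset {a : Config D A} (ω : ProperBaseRay S a) (r : ℕ) :
    (ω.rayAt r).dom ⊆ (ω.sectionRay r).dom :=
  Subset.refl _

/-- The inverse limit of the groups `π_k(X_r, a_r)`, based along the image of `ω` under the
sections determined by `a`. -/
def ProjPiAlong (k : ℕ) {a : Config D A} (ω : ProperBaseRay S a) : Type u :=
  InvLim (fun r => RayPi k (TileSpace S r) (ω.sectionRay r))
    fun _ _ h => RayPi.map (restrictMap S h).spaceMap (ω.sectionRay_dom h)
      fun _ => restrict_sectionMap a h _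

/-- The `k`-th homotopy signature of `a`. -/
noncomputable def homotopySignature (k : ℕ) {a : Config D A} (ω : ProperBaseRay S a)
    (u : RegionPi k ω) : ProjPiAlong k ω :=
  ⟨fun r => RayPi.map (sectionMap S a r) (ω.rayAt_dom_subset r) (fun _ => rfl) (u.1 r), fun r s h =>
    (RayPi.map_square _ _ (regionMap S a h) (sectionMap S a r) _ _ _ _ (ω.rayAt_dom h)
      (fun _ => rfl) _ _ (fun p => restrict_sectionMap a h p) _).trans
    (congrArg _ (u.2 r s h))⟩

/-- `a` has a homotopy defect of codimension `k + 1`: its `k`-th homotopy signature (along some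
proper base ray) is nontrivial. -/
def HasHomotopyDefect (S : Set (Config D A)) (k : ℕ) (a : Config D A) : Prop :=
  a ∈ slightlyDefective S ∧ ∃ (ω : ProperBaseRay S a) (u : RegionPi k ω) (r : ℕ),
    ¬ ((homotopySignature k ω u).1 r).IsOne

end ProjectiveHomotopy

/-! ### Projective (co)homology groups and (co)homology defects -/

section ProjectiveHomology

variable {D : ℕ} {A : Type u} (S : Set (Config D A)) (G : Type w) [AddCommGroup G] (k : ℕ)

/-- The projective homology group `H_k(S, G)`: the inverse limit of the groups `H_k(X_r, G)`. -/
noncomputable def ProjHomology : AddSubgroup (∀ r, (tileComplex S r).Homology G k) :=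
  invLimGroup (fun r => (tileComplex S r).Homology G k)
    fun _ _ h => (restrictMap S h).cellMap.homologyMap G k

/-- The projective cohomology group `H^k(S, G)`: the direct limit of the groups `H^k(X_r, G)`. -/
abbrev ProjCohomology : Type _ :=
  AddCommGroup.DirectLimit (fun r => (tileComplex S r).Cohomology G k)
    fun _ _ h => (restrictMap S h).cellMap.cohomologyMap G k

/-- The group `H_k(G_∞(a), G)`: the inverse limit of the groups `H_k(G_r(a), G)`. -/
noncomputable def RegionHomology (a : Config D A) :
    AddSubgroup (∀ r, (regionComplex (unflawed S a r)).Homology G k) :=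
  invLimGroup (fun r => (regionComplex (unflawed S a r)).Homology G k)
    fun _ _ h => (regionIncl (unflawed_anti S a h)).homologyMap G k

/-- The group `H^k(G_∞(a), G)`: the direct limit of the groups `H^k(G_r(a), G)`. -/
abbrev RegionCohomology (a : Config D A) : Type _ :=
  AddCommGroup.DirectLimit (fun r => (regionComplex (unflawed S a r)).Cohomology G k)
    fun _ _ h => (regionIncl (unflawed_anti S a h)).cohomologyMap G k

variable {S}

/-- The endomorphism `H_k Φ` of `H_k(S, G)`. -/
noncomputable def projHomologyMap {Φ : Config D A → Config D A} {q : ℕ} (hq : HasRadius Φ q)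
    (hS : MapsTo Φ S S) : ProjHomology S G k →+ ProjHomology S G k where
  toFun u := ⟨fun r => (caMap hq hS r).cellMap.homologyMap G k (u.1 (r + q)), fun r s h =>
    (CubicalComplex.Hom.homologyMap_square _ _ _ _
      (BlockMap.cellMap_square _ _ _ _ (caMap_restrict hq hS h)) _ _).trans
    (congrArg _ (u.2 _ _ (Nat.add_le_add_right h q)))⟩
  map_zero' := Subtype.ext (funext fun _ => map_zero _)
  map_add' _ _ := Subtype.ext (funext fun _ => map_add _ _ _)

/-- The endomorphism `H^k Φ` of `H^k(S, G)`. -/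
noncomputable def projCohomologyMap {Φ : Config D A → Config D A} {q : ℕ} (hq : HasRadius Φ q)
    (hS : MapsTo Φ S S) : ProjCohomology S G k →+ ProjCohomology S G k :=
  AddCommGroup.DirectLimit.lift _ _ _
    (fun r => (AddCommGroup.DirectLimit.of _ _ (r + q)).comp
      ((caMap hq hS r).cellMap.cohomologyMap G k))
    fun r s h x => by
      simp only [AddMonoidHom.comp_apply]
      rw [CubicalComplex.Hom.cohomologyMap_square _ _ _ _
        (BlockMap.cellMap_square _ _ _ _ (caMap_restrict hq hS h))]
      exact AddCommGroup.DirectLimit.of_f (Nat.add_le_add_right h q) _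

variable (S)

/-- The `k`-th homology signature `H_k(G_∞(a), G) → H_k(S, G)` of `a`. -/
noncomputable def homologySignature (a : Config D A) :
    RegionHomology S G k a →+ ProjHomology S G k where
  toFun u := ⟨fun r => (sectionHom S a r).homologyMap G k (u.1 r), fun r s h =>
    (CubicalComplex.Hom.homologyMap_square _ _ _ _ (restrict_sectionHom a h) _ _).trans
    (congrArg _ (u.2 r s h))⟩
  map_zero' := Subtype.ext (funext fun _ => map_zero _)
  map_add' _ _ := Subtype.ext (funext fun _ => map_add _ _ _)

/-- The `k`-th cohomology signature `H^k(S, G) → H^k(G_∞(a), G)` of `a`. -/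
noncomputable def cohomologySignature (a : Config D A) :
    ProjCohomology S G k →+ RegionCohomology S G k a :=
  AddCommGroup.DirectLimit.map (fun r => (sectionHom S a r).cohomologyMap G k) fun r s h =>
    AddMonoidHom.ext fun x =>
      CubicalComplex.Hom.cohomologyMap_square _ _ _ _ (restrict_sectionHom a h) _ _

/-- `a` has a homology defect of codimension `k + 1`. -/
def HasHomologyDefect (a : Config D A) : Prop :=
  a ∈ slightlyDefective S ∧ homologySignature S G k a ≠ 0

/-- `a` has a cohomology defect of codimension `k + 1`. -/
def HasCohomologyDefect (a : Config D A) : Prop :=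
  a ∈ slightlyDefective S ∧ cohomologySignature S G k a ≠ 0

end ProjectiveHomology

end CADefect

open CADefect

/-! The signatures are natural. A block of radius r + q determines the Φ-image of its central
r-block, so G_(r+q)(a) lies in G_r(Φ a), and Φ_* composed with the section of `a` at radius r + q is
the section of Φ a at radius r restricted to G_(r+q)(a) (`caMap_sectionHom`, `caMap_sectionMap`).
Hence Φ applied to the signature of `a` factors through the signature of Φ a. If the latter is
trivial, injectivity of Φ on homology, or dually surjectivity on cohomology, makes the former
trivial. Conversely a nontrivial signature excludes membership in S: for a in S every region G_r(a)
is all of ℝ^D, whose homotopy groups vanish by convexity and whose cubical (co)homology in positive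
degree vanishes by a discrete Poincaré lemma (`exists_faceCobd_eq`, `exists_faceBdry_eq`). The
hypothesis on Φ does not mention `a`, so the step from `a` to Φ a can be iterated.

For homotopy the difficulty is the base point: signatures live along the image of a ray in X_r,
while injectivity is known only at x_r(c). Weak mixing makes each X_r path connected, so the loops
can be moved to x_r(c); but the paths are chosen separately for each r, and the moved loops are
compatible only up to free homotopy. If the tower of fundamental groups is abelian (k = 1) or
trivial, freely homotopic loops far up the tower become homotopic lower down (`CollapsesFree`), and
pushing the moved loops down yields a genuine element of π_k(S, c). Triviality itself needs no base
point: a loop freely homotopic to a constant is null-homotopic (`FreelyHomotopic.homotopic_const`).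
This gives `homotopic_const_of_injective`. Injectivity on vertices forces S to have at most one
element; then X_r is a copy of ℝ^D and carries no nontrivial class. -/

namespace CADefect

/-! ### Free homotopies of cubes and their base point tracks -/

section FreeHomotopy

variable {N : Type*} {X : Type*} [TopologicalSpace X] {Y : Type*} [TopologicalSpace Y]

/-- The homotopy extension property of `(I^N, ∂I^N)`, for homotopies which are constant on the
boundary at each time. -/
theorem exists_extension_of_boundary [Finite N] (f : C(N → I, X)) (δ : C(I, X))
    (h : ∀ p ∈ Cube.boundary N, f p = δ 0) :
    ∃ F : C(I × (N → I), X), (∀ p, F (0, p) = f p) ∧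
      ∀ t, ∀ p ∈ Cube.boundary N, F (t, p) = δ t := by
  classical
  have := Fintype.ofFinite N
  -- The cube is the closed unit ball of the sup norm around its midpoint, `m` is the distance from
  -- the midpoint, and `m = 1` on the boundary.
  let m : (N → I) → ℝ := fun p => ‖fun i => 2 * (p i : ℝ) - 1‖
  have hm : Continuous m := by fun_prop
  have hm1 : ∀ p, m p ≤ 1 := fun p => (pi_norm_le_iff_of_nonneg zero_le_one).2 fun i => by
    rw [Real.norm_eq_abs, abs_le]
    constructor <;> linarith [(p i).2.1, (p i).2.2]
  have hmb : ∀ p ∈ Cube.boundary N, m p = 1 := by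
    rintro p ⟨i, hi⟩
    refine le_antisymm (hm1 p) (le_trans ?_ (norm_le_pi_norm (fun i => 2 * (p i : ℝ) - 1) i))
    rcases hi with hi | hi <;> simp [hi] <;> norm_num
  let e : I × (N → I) → N → I := fun q i =>
    projIcc 0 1 zero_le_one ((1 + (1 + (q.1 : ℝ)) * (2 * (q.2 i : ℝ) - 1)) / 2)
  have he : Continuous e :=
    continuous_pi fun i => continuous_projIcc.comp (by fun_prop)
  -- At time t the inner cube of radius 1/(1+t) carries a rescaled copy of `f`, and the collar
  -- outside it carries δ on [0, t]. In the branches where they are used, the two `projIcc` never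
  -- clip.
  let F : I × (N → I) → X := fun q => if (1 + (q.1 : ℝ)) * m q.2 ≤ 1 then f (e q)
    else δ (projIcc 0 1 zero_le_one ((1 + (q.1 : ℝ)) * m q.2 - 1))
  have hF : Continuous F := by
    refine Continuous.if_le (f.continuous.comp he)
      (δ.continuous.comp (continuous_projIcc.comp (by fun_prop))) (by fun_prop)
      continuous_const ?_
    intro q hq
    have ht : (0 : ℝ) < 1 + q.1 := by linarith [q.1.2.1]
    -- On the interface the rescaled point must lie on the boundary: otherwise every coordinate is
    -- strictly inside, and a finite supremum of such values stays strictly below 1/(1+t).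
    have hb : e q ∈ Cube.boundary N := by
      by_contra hb
      have hlt : ∀ i, ‖2 * (q.2 i : ℝ) - 1‖ < 1 / (1 + q.1) := by
        intro i
        rw [lt_div_iff₀ ht]
        have hle : ‖2 * (q.2 i : ℝ) - 1‖ * (1 + q.1) ≤ 1 := by
          rw [mul_comm]
          exact (mul_le_mul_of_nonneg_left
            (norm_le_pi_norm (fun i => 2 * (q.2 i : ℝ) - 1) i) ht.le).trans hq.le
        refine lt_of_le_of_ne hle fun heq => hb ⟨i, ?_⟩
        rw [Real.norm_eq_abs] at heq
        nth_rw 1 [← abs_of_pos ht] at heq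
        rw [← abs_mul] at heq
        rcases (abs_eq zero_le_one).1 heq with h1 | h1
        · right
          refine projIcc_of_right_le _ ?_
          linarith
        · left
          refine projIcc_of_le_left _ ?_
          linarith
      have : m q.2 < 1 / (1 + q.1) := (pi_norm_lt_iff (by positivity)).2 hlt
      rw [lt_div_iff₀ ht, mul_comm] at this
      linarith
    rw [h _ hb, hq, sub_self, projIcc_left]
    rfl
  refine ⟨⟨F, hF⟩, fun p => ?_, fun t p hp => ?_⟩
  · have h1 : (1 + ((0 : I) : ℝ)) * m p ≤ 1 := by simpa using hm1 p
    change (if _ then _ else _) = _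
    rw [if_pos h1]
    congr 1
    funext i
    have : (1 + (1 + ((0 : I) : ℝ)) * (2 * (p i : ℝ) - 1)) / 2 = p i := by
      rw [show ((0 : I) : ℝ) = 0 from rfl]; ring
    change projIcc 0 1 zero_le_one _ = _
    rw [this, projIcc_val]
  · change (if _ then _ else _) = _
    simp only [hmb p hp, mul_one, add_sub_cancel_left, projIcc_val]
    split_ifs with h1
    · have ht : t = 0 := le_antisymm (by rw [← Subtype.coe_le_coe]; simpa using h1) t.2.1
      subst ht
      rw [← h p hp]
      congr 1
      funext i
      have : (1 + (1 + ((0 : I) : ℝ)) * (2 * (p i : ℝ) - 1)) / 2 = p i := by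
        rw [show ((0 : I) : ℝ) = 0 from rfl]; ring
      change projIcc 0 1 zero_le_one _ = _
      rw [this, projIcc_val]
    · rfl

/-! ### Free homotopies with a prescribed track of the base point -/

variable {k : ℕ}

/-- `f` is freely homotopic to `g`, by a homotopy which moves the base point along `γ`. -/
def TrackHomotopic {x y : X} (γ : Path x y) (f : GenLoop (Fin k) X x)
    (g : GenLoop (Fin k) X y) : Prop :=
  ∃ H : C(I × (Fin k → I), X), (∀ p, H (0, p) = f p) ∧ (∀ p, H (1, p) = g p) ∧
    ∀ s, ∀ p ∈ Cube.boundary (Fin k), H (s, p) = γ s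

/-- `f` is freely homotopic to `g`, through maps which are constant on the boundary. -/
def FreelyHomotopic {x y : X} (f : GenLoop (Fin k) X x) (g : GenLoop (Fin k) X y) : Prop :=
  ∃ γ : Path x y, TrackHomotopic γ f g

namespace TrackHomotopic

variable {x y z : X} {γ : Path x y} {δ : Path y z} {f : GenLoop (Fin k) X x}
  {g : GenLoop (Fin k) X y}
  {l : GenLoop (Fin k) X z}

theorem symm (h : TrackHomotopic γ f g) : TrackHomotopic γ.symm g f := by
  obtain ⟨H, h0, h1, hb⟩ := h
  refine ⟨⟨fun q => H (σ q.1, q.2), by fun_prop⟩, fun p => ?_, fun p => ?_, fun s p hp => ?_⟩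
  · simpa using h1 p
  · simpa using h0 p
  · exact hb _ p hp

theorem trans (h : TrackHomotopic γ f g) (h' : TrackHomotopic δ g l) :
    TrackHomotopic (γ.trans δ) f l := by
  obtain ⟨H, h0, h1, hb⟩ := h
  obtain ⟨H', h0', h1', hb'⟩ := h'
  let K : ContinuousMap.Homotopy f.1 g.1 := ⟨H, h0, h1⟩
  let K' : ContinuousMap.Homotopy g.1 l.1 := ⟨H', h0', h1'⟩
  refine ⟨(K.trans K').toContinuousMap, (K.trans K').apply_zero, (K.trans K').apply_one,
    fun s p hp => ?_⟩
  change K.trans K' (s, p) = _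
  rw [ContinuousMap.Homotopy.trans_apply, Path.trans_apply]
  split_ifs
  · exact hb _ p hp
  · exact hb' _ p hp

theorem of_homotopic {f' : GenLoop (Fin k) X x} (h : GenLoop.Homotopic f f') :
    TrackHomotopic (Path.refl x) f f' := by
  obtain ⟨H⟩ := h
  refine ⟨H.toContinuousMap, H.apply_zero, H.apply_one, fun s p hp => ?_⟩
  exact (H.prop s p hp).trans (GenLoop.boundary f p hp)

theorem map (φ : C(X, Y)) {x' y' : Y} (hx : φ x = x') (hy : φ y = y')
    (h : TrackHomotopic γ f g) :
    TrackHomotopic ((γ.map φ.continuous).cast hx.symm hy.symm) (mapLoop φ hx f)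
      (mapLoop φ hy g) := by
  obtain ⟨H, h0, h1, hb⟩ := h
  exact ⟨φ.comp H, fun p => congrArg φ (h0 p), fun p => congrArg φ (h1 p),
    fun s p hp => congrArg φ (hb s p hp)⟩

theorem const (γ : Path x y) :
    TrackHomotopic γ (GenLoop.const : GenLoop (Fin k) X x) (GenLoop.const : GenLoop (Fin k) X y) :=
  ⟨⟨fun q => γ q.1, by fun_prop⟩, fun _ => γ.source, fun _ => γ.target, fun _ _ _ => rfl⟩

/-- Change of base point: extend `g` while its boundary value runs back along γ, and read the
resulting homotopy in reverse. -/
theorem exists_left (γ : Path x y) (g : GenLoop (Fin k) X y) :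
    ∃ f : GenLoop (Fin k) X x, TrackHomotopic γ f g := by
  obtain ⟨F, h0, hb⟩ := exists_extension_of_boundary g.1 γ.symm.toContinuousMap
    fun p hp => (GenLoop.boundary g p hp).trans γ.symm.source.symm
  refine ⟨⟨⟨fun p => F (1, p), by fun_prop⟩, fun p hp => (hb 1 p hp).trans γ.symm.target⟩, ?_⟩
  refine ⟨⟨fun q => F (σ q.1, q.2), by fun_prop⟩, fun p => ?_, fun p => ?_, fun s p hp => ?_⟩
  · change F (σ 0, p) = F (1, p)
    rw [unitInterval.symm_zero]
  · change F (σ 1, p) = _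
    rw [unitInterval.symm_one]
    exact h0 p
  · change F (σ s, p) = _
    rw [hb _ p hp]
    change γ (σ (σ s)) = _
    rw [unitInterval.symm_symm]

/-- The extension property is applied to maps from the cube to the path space `C(I, X)`: p goes to
the path s ↦ H(s, p), which for boundary p is γ and is contracted by `K`. The result `E` joins `f`
to `g` along the sides s = 0, t = 1 and s = 1, and on each of these the boundary of the cube stays
at x. -/
theorem homotopic {γ : Path x x} {f g : GenLoop (Fin k) X x} (h : TrackHomotopic γ f g)
    (hγ : γ.Homotopic (Path.refl x)) : GenLoop.Homotopic f g := by
  obtain ⟨H, h0, h1, hb⟩ := h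
  obtain ⟨K⟩ := hγ
  let H' : C(Fin k → I, C(I, X)) := (H.comp ContinuousMap.prodSwap).curry
  let K' : C(I, C(I, X)) := K.toContinuousMap.curry
  obtain ⟨F, hF0, hFb⟩ := exists_extension_of_boundary H' K' fun p hp => by
    ext s
    change H (s, p) = K (0, s)
    rw [hb s p hp, K.apply_zero]; rfl
  let E : C((I × (Fin k → I)) × I, X) := F.uncurry
  have hE0 : ∀ p s, E ((0, p), s) = H (s, p) := fun p s => DFunLike.congr_fun (hF0 p) s
  have hEb : ∀ t s, ∀ p ∈ Cube.boundary (Fin k), E ((t, p), s) = K (t, s) :=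
    fun t s p hp => DFunLike.congr_fun (hFb t p hp) s
  have hK0 : ∀ t, K (t, 0) = x := fun t => K.source t
  have hK1 : ∀ t, K (t, 1) = x := fun t => K.target t
  have hKr : ∀ s, K (1, s) = x := fun s => K.apply_one s
  let f₁ : GenLoop (Fin k) X x := ⟨⟨fun p => E ((1, p), 0), by fun_prop⟩,
    fun p hp => (hEb 1 0 p hp).trans (hK0 1)⟩
  let g₁ : GenLoop (Fin k) X x := ⟨⟨fun p => E ((1, p), 1), by fun_prop⟩,
    fun p hp => (hEb 1 1 p hp).trans (hK1 1)⟩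
  have hf : GenLoop.Homotopic f f₁ := ⟨⟨⟨⟨fun q => E ((q.1, q.2), 0), by fun_prop⟩,
    fun p => (hE0 p 0).trans (h0 p), fun _ => rfl⟩, fun t p hp =>
      ((hEb t 0 p hp).trans (hK0 t)).trans (GenLoop.boundary f p hp).symm⟩⟩
  have hg : GenLoop.Homotopic g g₁ := ⟨⟨⟨⟨fun q => E ((q.1, q.2), 1), by fun_prop⟩,
    fun p => (hE0 p 1).trans (h1 p), fun _ => rfl⟩, fun t p hp =>
      ((hEb t 1 p hp).trans (hK1 t)).trans (GenLoop.boundary g p hp).symm⟩⟩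
  have hfg : GenLoop.Homotopic f₁ g₁ := ⟨⟨⟨⟨fun q => E ((1, q.2), q.1), by fun_prop⟩,
    fun _ => rfl, fun _ => rfl⟩, fun t p hp =>
      ((hEb 1 t p hp).trans (hKr t)).trans (GenLoop.boundary f₁ p hp).symm⟩⟩
  exact (hf.trans hfg).trans hg.symm

end TrackHomotopic

namespace FreelyHomotopic

variable {x y z : X} {f : GenLoop (Fin k) X x} {g : GenLoop (Fin k) X y} {l : GenLoop (Fin k) X z}

theorem symm : FreelyHomotopic f g → FreelyHomotopic g f := fun ⟨γ, h⟩ => ⟨γ.symm, h.symm⟩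

theorem trans : FreelyHomotopic f g → FreelyHomotopic g l → FreelyHomotopic f l :=
  fun ⟨γ, h⟩ ⟨δ, h'⟩ => ⟨γ.trans δ, h.trans h'⟩

theorem of_homotopic {f' : GenLoop (Fin k) X x} (h : GenLoop.Homotopic f f') :
    FreelyHomotopic f f' :=
  ⟨_, .of_homotopic h⟩

theorem refl (f : GenLoop (Fin k) X x) : FreelyHomotopic f f := of_homotopic (.refl f)

theorem map (φ : C(X, Y)) {x' y' : Y} (hx : φ x = x') (hy : φ y = y') :
    FreelyHomotopic f g → FreelyHomotopic (mapLoop φ hx f) (mapLoop φ hy g) :=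
  fun ⟨_, h⟩ => ⟨_, h.map φ hx hy⟩

/-- Once the loop is constant, the homotopy can be continued by constants back along γ; the total
track is γ followed by its reverse, which is null-homotopic. -/
theorem homotopic_const (h : FreelyHomotopic f (GenLoop.const : GenLoop (Fin k) X y)) :
    GenLoop.Homotopic f GenLoop.const := by
  obtain ⟨γ, h⟩ := h
  exact (h.trans (TrackHomotopic.const γ).symm).homotopic
    ⟨(Path.Homotopy.reflTransSymm γ).symm⟩

end FreelyHomotopic

/-! ### Dimension one: free homotopy as conjugation -/

/-- The path around a one-dimensional generalized loop. -/
def loopPath {x : X} (f : GenLoop (Fin 1) X x) : Path x x where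
  toFun t := f fun _ => t
  continuous_toFun := by
    exact (ContinuousMap.continuous f.1).comp (continuous_pi fun _ => continuous_id)
  source' := GenLoop.boundary f _ ⟨0, Or.inl rfl⟩
  target' := GenLoop.boundary f _ ⟨0, Or.inr rfl⟩

/-- The free homotopy is a square with two opposite sides γ and the other two the loops; the two
ways around its boundary are homotopic rel endpoints. -/
theorem TrackHomotopic.loopPath_trans {x y : X} {γ : Path x y} {f : GenLoop (Fin 1) X x}
    {g : GenLoop (Fin 1) X y} (h : TrackHomotopic γ f g) :
    ((loopPath f).trans γ).Homotopic (γ.trans (loopPath g)) := by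
  obtain ⟨H, h0, h1, hb⟩ := h
  let F : ContinuousMap.Homotopy (loopPath f).toContinuousMap (loopPath g).toContinuousMap :=
    ⟨⟨fun q => H (q.1, fun _ => q.2), by fun_prop⟩, fun p => h0 _, fun p => h1 _⟩
  obtain ⟨K⟩ := Path.Homotopic.map_trans_evalAt F Path.id
  have hγ0 : ∀ s, H (s, fun _ => 0) = γ s := fun s => hb s _ ⟨0, Or.inl rfl⟩
  have hγ1 : ∀ s, H (s, fun _ => 1) = γ s := fun s => hb s _ ⟨0, Or.inr rfl⟩
  refine ⟨⟨⟨K.toContinuousMap, fun t => (K.apply_zero t).trans ?_,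
    fun t => (K.apply_one t).trans ?_⟩, ?_⟩⟩
  · change (Path.trans _ _) t = (Path.trans _ _) t
    rw [Path.trans_apply, Path.trans_apply]
    split_ifs
    · rfl
    · exact hγ1 _
  · change (Path.trans _ _) t = (Path.trans _ _) t
    rw [Path.trans_apply, Path.trans_apply]
    split_ifs
    · exact hγ0 _
    · rfl
  · rintro t p (rfl | rfl)
    · refine (K.source t).trans ?_
      exact (loopPath f).source.trans ((loopPath f).trans γ).source.symm
    · refine (K.target t).trans ?_
      exact (loopPath g).target.trans ((loopPath f).trans γ).target.symm

theorem homotopic_of_loopPath {x : X} {f g : GenLoop (Fin 1) X x}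
    (h : (loopPath f).Homotopic (loopPath g)) : GenLoop.Homotopic f g := by
  obtain ⟨K⟩ := h
  refine ⟨⟨⟨⟨fun q => K (q.1, q.2 0), by fun_prop⟩, fun p => ?_, fun p => ?_⟩, ?_⟩⟩
  · have : (fun _ => p 0) = p := funext fun i => by rw [Subsingleton.elim i 0]
    refine (K.apply_zero (p 0)).trans ?_
    change f _ = f p
    rw [this]
  · have : (fun _ => p 0) = p := funext fun i => by rw [Subsingleton.elim i 0]
    refine (K.apply_one (p 0)).trans ?_
    change g _ = g p
    rw [this]
  · rintro t p ⟨i, hi⟩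
    rw [Subsingleton.elim i 0] at hi
    refine Eq.trans ?_ (GenLoop.boundary f p ⟨0, hi⟩).symm
    change K (t, p 0) = x
    rcases hi with hi | hi
    · rw [hi]; exact K.source t
    · rw [hi]; exact K.target t

/-- A retract of a topological vector space has trivial homotopy groups. -/
theorem homotopic_const_of_retract {E : Type*} [TopologicalSpace E] [AddCommGroup E] [Module ℝ E]
    [ContinuousAdd E] [ContinuousSMul ℝ E] (i : C(X, E)) (r : C(E, X)) (h : ∀ x, r (i x) = x)
    {x : X} (f : GenLoop (Fin k) X x) : GenLoop.Homotopic f GenLoop.const := by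
  refine ⟨⟨⟨⟨fun q => r ((1 - (q.1 : ℝ)) • i (f q.2) + (q.1 : ℝ) • i x), by
    have : Continuous f := f.1.continuous
    fun_prop⟩, fun p => ?_, fun p => ?_⟩, ?_⟩⟩
  · simp [h]
  · simp [h]
  · intro t p hp
    simp [GenLoop.boundary f p hp, ← add_smul, h]

end FreeHomotopy

/-! ### The cubical Poincaré lemma -/

section Poincare

variable {M : Type*} [AddCommGroup M] {M' : Type*} [AddCommGroup M']

/-- The discrete antiderivative of `φ` which vanishes at `0`. -/
noncomputable def antideriv (φ : ℤ → M) (n : ℤ) : M :=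
  ∑ j ∈ Finset.Ico 0 n, φ j - ∑ j ∈ Finset.Ico n 0, φ j

theorem antideriv_zero (φ : ℤ → M) : antideriv φ 0 = 0 := by simp [antideriv]

theorem antideriv_succ (φ : ℤ → M) (n : ℤ) : antideriv φ (n + 1) = antideriv φ n + φ n := by
  unfold antideriv
  rcases le_or_gt 0 n with h | h
  · have e1 : Finset.Ico 0 (n + 1) = insert n (Finset.Ico 0 n) := by
      ext j; simp only [Finset.mem_Ico, Finset.mem_insert]; omega
    rw [e1, Finset.sum_insert (by simp), Finset.Ico_eq_empty (by omega : ¬ n < 0),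
      Finset.Ico_eq_empty (by omega : ¬ n + 1 < 0)]
    simp [add_comm]
  · have e1 : Finset.Ico n 0 = insert n (Finset.Ico (n + 1) 0) := by
      ext j; simp only [Finset.mem_Ico, Finset.mem_insert]; omega
    rw [e1, Finset.sum_insert (by simp), Finset.Ico_eq_empty (by omega : ¬ (0 : ℤ) < n),
      Finset.Ico_eq_empty (by omega : ¬ (0 : ℤ) < n + 1)]
    simp

theorem map_antideriv (f : M →+ M') (φ : ℤ → M) (n : ℤ) :
    f (antideriv φ n) = antideriv (fun j => f (φ j)) n := by
  simp [antideriv, map_sum]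

theorem antideriv_sum {ι : Type*} (s : Finset ι) (φ : ι → ℤ → M) (n : ℤ) :
    antideriv (fun j => ∑ i ∈ s, φ i j) n = ∑ i ∈ s, antideriv (φ i) n := by
  simp only [antideriv, Finset.sum_sub_distrib]
  rw [Finset.sum_comm]
  congr 1
  rw [Finset.sum_comm]

theorem antideriv_add (φ ψ : ℤ → M) (n : ℤ) :
    antideriv (fun j => φ j + ψ j) n = antideriv φ n + antideriv ψ n := by
  simp only [antideriv, Finset.sum_add_distrib]; abel

theorem antideriv_sub (φ ψ : ℤ → M) (n : ℤ) :
    antideriv (fun j => φ j - ψ j) n = antideriv φ n - antideriv ψ n := by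
  simp only [antideriv, Finset.sum_sub_distrib]; abel

theorem antideriv_zsmul (m : ℤ) (φ : ℤ → M) (n : ℤ) :
    antideriv (fun j => m • φ j) n = m • antideriv φ n := by
  simp only [antideriv, ← Finset.smul_sum, smul_sub]

theorem antideriv_diff (φ : ℤ → M) (n : ℤ) :
    antideriv (fun j => φ (j + 1) - φ j) n = φ n - φ 0 := by
  induction n with
  | zero => simp [antideriv_zero]
  | succ n ih => rw [antideriv_succ, ih]; abel
  | pred n ih =>
    have := antideriv_succ (fun j => φ (j + 1) - φ j) (-(n : ℤ) - 1)
    rw [sub_add_cancel, ih] at this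
    rw [← sub_eq_of_eq_add this]; abel

/-! ### Integration of cubical cochains along one axis -/

variable {D : ℕ}

/-- The sign of the direction `i` relative to the set of directions `T`. -/
def dirSign (T : Finset (Fin D)) (i : Fin D) : ℤ := (-1) ^ (T.filter (· < i)).card

theorem dirSign_mul_self (T : Finset (Fin D)) (i : Fin D) : dirSign T i * dirSign T i = 1 := by
  rw [dirSign, ← mul_pow]; simp

theorem dirSign_erase_self (T : Finset (Fin D)) (i : Fin D) :
    dirSign (T.erase i) i = dirSign T i := by
  unfold dirSign
  congr 2
  ext j
  simp only [Finset.mem_filter, Finset.mem_erase]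
  exact ⟨fun h => ⟨h.1.2, h.2⟩, fun h => ⟨⟨h.2.ne, h.1⟩, h.2⟩⟩

theorem dirSign_insert_self (T : Finset (Fin D)) (i : Fin D) :
    dirSign (insert i T) i = dirSign T i := by
  unfold dirSign
  rw [Finset.filter_insert, if_neg (lt_irrefl i)]

theorem dirSign_insert_of_lt {T : Finset (Fin D)} {i j : Fin D} (hi : i ∉ T) (h : i < j) :
    dirSign (insert i T) j = - dirSign T j := by
  unfold dirSign
  rw [Finset.filter_insert, if_pos h, Finset.card_insert_of_notMem (by simp [hi]), pow_succ]
  ring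

theorem dirSign_insert_of_not_lt {T : Finset (Fin D)} {i j : Fin D} (h : ¬ i < j) :
    dirSign (insert i T) j = dirSign T j := by
  unfold dirSign
  rw [Finset.filter_insert, if_neg h]

/-- Inserting i and deleting j anticommute: whichever of the two is smaller, exactly one of the two
orders picks up a sign. This cancels the mixed terms in `faceCobd_axisHomotopy`. -/
theorem dirSign_mul_erase {T : Finset (Fin D)} {i j : Fin D} (hi : i ∉ T) (hj : j ∈ T) :
    dirSign T j * dirSign (T.erase j) i = - (dirSign T i * dirSign (insert i T) j) := by
  have hij : i ≠ j := fun h => hi (h ▸ hj)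
  have e : dirSign T i = dirSign (insert j (T.erase j)) i := by rw [Finset.insert_erase hj]
  rcases lt_or_gt_of_ne hij with h | h
  · rw [e, dirSign_insert_of_lt hi h, dirSign_insert_of_not_lt h.asymm]; ring
  · rw [e, dirSign_insert_of_not_lt h.asymm, dirSign_insert_of_lt (by simp) h]; ring

/-- The translate of `F` along the `i`-th axis with `i`-th coordinate `n`. -/
def Face.moveTo (i : Fin D) (n : ℤ) (F : Face D) : Face D := ⟨Function.update F.base i n, F.dirs⟩

/-- The product of the projection of `F` along the `i`-th axis with `[n, n + 1]`. -/
def Face.thickenAt (i : Fin D) (n : ℤ) (F : Face D) : Face D :=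
  ⟨Function.update F.base i n, insert i F.dirs⟩

/-- The pullback of cochains along the projection to the hyperplane where the `i`-th coordinate
vanishes. -/
def axisProj (i : Fin D) (η : Face D → M) (F : Face D) : M :=
  if i ∈ F.dirs then 0 else η (F.moveTo i 0)

/-- The cochain homotopy from the identity to `axisProj`. -/
noncomputable def axisHomotopy (i : Fin D) (η : Face D → M) (F : Face D) : M :=
  if i ∈ F.dirs then 0 else
    dirSign F.dirs i • antideriv (fun n => η (F.thickenAt i n)) (F.base i)

/-- The cubical coboundary operator of `ℝ^D`. -/
def faceCobd (η : Face D → M) (F : Face D) : M :=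
  ∑ j ∈ F.dirs, dirSign F.dirs j • (η (F.upper j) - η (F.lower j))

theorem Face.thickenAt_lower {i j : Fin D} (hij : i ≠ j) (n : ℤ) (F : Face D) :
    (F.lower j).thickenAt i n = (F.thickenAt i n).lower j := by
  ext1
  · rfl
  · exact (Finset.erase_insert_of_ne hij).symm

theorem Face.thickenAt_upper {i j : Fin D} (hij : i ≠ j) (n : ℤ) {F : Face D} (hj : j ∈ F.dirs) :
    (F.upper j).thickenAt i n = (F.thickenAt i n).upper j := by
  ext1
  · simp only [Face.thickenAt, Face.upper, hj, Finset.mem_insert, or_true, if_true]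
    ext l
    by_cases hl : l = i
    · subst hl; simp [hij]
    · simp [hl]
  · exact (Finset.erase_insert_of_ne hij).symm

theorem Face.moveTo_lower (i j : Fin D) (n : ℤ) (F : Face D) :
    (F.lower j).moveTo i n = (F.moveTo i n).lower j := rfl

theorem Face.moveTo_upper {i j : Fin D} (hij : i ≠ j) (n : ℤ) {F : Face D} (hj : j ∈ F.dirs) :
    (F.upper j).moveTo i n = (F.moveTo i n).upper j := by
  ext1
  · simp only [Face.moveTo, Face.upper, hj, if_true]
    ext l
    by_cases hl : l = i
    · subst hl; simp [hij]
    · simp [hl]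
  · rfl

/-- The projection collapses the direction i, so the two i-facets of a face extended in that
direction have the same image and their contributions cancel. -/
theorem faceCobd_axisProj (i : Fin D) (η : Face D → M) :
    faceCobd (axisProj i η) = axisProj i (faceCobd η) := by
  funext F
  rw [faceCobd]
  by_cases hi : i ∈ F.dirs
  · rw [axisProj, if_pos hi]
    refine Finset.sum_eq_zero fun j hj => ?_
    by_cases hij : i = j
    · subst hij
      have e : (F.upper i).moveTo i 0 = (F.lower i).moveTo i 0 := by
        ext1
        · simp only [Face.moveTo, Face.upper, Face.lower, hi, if_true]
          ext l
          by_cases hl : l = i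
          · subst hl; simp
          · simp [hl]
        · rfl
      rw [axisProj, axisProj, if_neg (by simp [Face.upper]), if_neg (by simp [Face.lower]), e,
        sub_self, smul_zero]
    · rw [axisProj, axisProj, if_pos (by simp [Face.upper, hi, hij]),
        if_pos (by simp [Face.lower, hi, hij]), sub_self, smul_zero]
  · rw [axisProj, if_neg hi, faceCobd]
    refine Finset.sum_congr rfl fun j hj => ?_
    have hij : i ≠ j := fun h => hi (h ▸ hj)
    rw [axisProj, axisProj, if_neg (by simp [Face.upper, hi]), if_neg (by simp [Face.lower, hi]),
      Face.moveTo_upper hij 0 (F := F) hj, Face.moveTo_lower]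
    rfl

/-- The fundamental theorem of calculus along axis i. On a face containing i, differencing the
antiderivative returns η. On the other faces, summing the i-difference gives η minus its value at
coordinate 0, and the remaining directions cancel by sign. -/
theorem faceCobd_axisHomotopy (i : Fin D) (η : Face D → M) (F : Face D) :
    faceCobd (axisHomotopy i η) F +
      axisHomotopy i (faceCobd η) F = η F - axisProj i η F := by
  rw [faceCobd]
  by_cases hi : i ∈ F.dirs
  · rw [axisProj, if_pos hi]
    rw [show axisHomotopy i (faceCobd η) F = 0 from if_pos hi, add_zero, sub_zero,
      Finset.sum_eq_single i]
    · have e1 : ∀ n, (F.upper i).thickenAt i n = F.moveTo i n := fun n => by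
        ext1
        · simp only [Face.moveTo, Face.upper, Face.thickenAt, hi, if_true]
          ext l
          by_cases hl : l = i
          · subst hl; simp
          · simp [hl]
        · exact Finset.insert_erase hi
      have e2 : ∀ n, (F.lower i).thickenAt i n = F.moveTo i n := fun n => by
        ext1
        · rfl
        · exact Finset.insert_erase hi
      have e3 : (F.upper i).base i = F.base i + 1 := by simp [Face.upper, hi]
      have e4 : F.moveTo i (F.base i) = F := by
        ext1
        · exact Function.update_eq_self _ _
        · rfl
      rw [axisHomotopy, axisHomotopy, if_neg (by simp [Face.upper]), if_neg (by simp [Face.lower])]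
      simp only [e1, e2, e3]
      rw [antideriv_succ]
      change _ • (dirSign (F.dirs.erase i) i • _ -
        dirSign (F.dirs.erase i) i • antideriv _ (F.base i)) = _
      rw [dirSign_erase_self, ← smul_sub, add_sub_cancel_left, smul_smul, dirSign_mul_self,
        one_smul, e4]
    · intro j _ hij
      rw [axisHomotopy, axisHomotopy, if_pos (by simp [Face.upper, hi, hij.symm]),
        if_pos (by simp [Face.lower, hi, hij.symm]), sub_self, smul_zero]
    · exact fun h => absurd hi h
  · rw [axisProj, if_neg hi]
    rw [show axisHomotopy i (faceCobd η) F = dirSign F.dirs i •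
      antideriv (fun n => faceCobd η (F.thickenAt i n)) (F.base i) from if_neg hi]
    have e1 : ∀ n, faceCobd η (F.thickenAt i n) =
        dirSign F.dirs i • (η (F.moveTo i (n + 1)) - η (F.moveTo i n)) +
        ∑ j ∈ F.dirs, dirSign (insert i F.dirs) j •
          (η ((F.upper j).thickenAt i n) - η ((F.lower j).thickenAt i n)) := by
      intro n
      rw [faceCobd]
      change ∑ j ∈ insert i F.dirs, dirSign (insert i F.dirs) j • _ = _
      rw [Finset.sum_insert hi, dirSign_insert_self]
      congr 1
      · have e2 : (F.thickenAt i n).upper i = F.moveTo i (n + 1) := by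
          ext1
          · simp only [Face.moveTo, Face.upper, Face.thickenAt, Finset.mem_insert_self, if_true]
            ext l
            by_cases hl : l = i
            · subst hl; simp
            · simp [hl]
          · exact Finset.erase_insert hi
        have e3 : (F.thickenAt i n).lower i = F.moveTo i n := by
          ext1
          · rfl
          · exact Finset.erase_insert hi
        rw [e2, e3]
      · refine Finset.sum_congr rfl fun j hj => ?_
        have hij : i ≠ j := fun h => hi (h ▸ hj)
        rw [Face.thickenAt_upper hij n hj, Face.thickenAt_lower hij]
    have e4 : F.moveTo i (F.base i) = F := by
      ext1
      · exact Function.update_eq_self _ _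
      · rfl
    simp only [e1]
    rw [antideriv_add, antideriv_zsmul, antideriv_diff (fun n => η (F.moveTo i n)), antideriv_sum,
      smul_add, smul_smul, dirSign_mul_self, one_smul, e4, Finset.smul_sum, add_comm, add_assoc,
      ← Finset.sum_add_distrib, add_eq_left]
    -- Term by term: differentiating in direction j and integrating along i anticommute.
    refine Finset.sum_eq_zero fun j hj => ?_
    have hij : i ≠ j := fun h => hi (h ▸ hj)
    have e5 : (F.upper j).base i = F.base i := by simp [Face.upper, hj, hij]
    rw [axisHomotopy, axisHomotopy, if_neg (by simp [Face.upper, hi]),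
      if_neg (by simp [Face.lower, hi]), e5]
    change _ + _ • (dirSign (F.dirs.erase j) i • _ -
      dirSign (F.dirs.erase j) i • antideriv _ (F.base i)) = 0
    rw [← smul_sub, smul_smul, dirSign_mul_erase hi hj, antideriv_zsmul, antideriv_sub, smul_smul,
      neg_smul, add_neg_cancel]

/-- The cohomology of `ℝ^D` vanishes in positive degrees. -/
theorem exists_faceCobd_eq {k : ℕ} {η : Face D → M} (hη : ∀ F, F.dirs.card ≠ k + 1 → η F = 0)
    (hd : faceCobd η = 0) :
    ∃ θ : Face D → M, (∀ F, F.dirs.card ≠ k → θ F = 0) ∧ faceCobd θ = η := by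
  -- Directions are eliminated one at a time: modulo a coboundary, η can be made to vanish on every
  -- face extended in a direction of `T`. For `T` the set of all directions nothing is left, since a
  -- face of dimension k + 1 has at least one direction.
  have key : ∀ T : Finset (Fin D), ∃ θ η' : Face D → M, (∀ F, F.dirs.card ≠ k → θ F = 0) ∧
      (∀ F, F.dirs.card ≠ k + 1 → η' F = 0) ∧ faceCobd η' = 0 ∧
      (∀ F, η F = faceCobd θ F + η' F) ∧ ∀ F : Face D, (∃ i ∈ T, i ∈ F.dirs) → η' F = 0 := by
    intro T
    induction T using Finset.induction_on with
    | empty => exact ⟨0, η, fun _ _ => rfl, hη, hd, fun F => by simp [faceCobd], by simp⟩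
    | insert i T _ ih =>
      obtain ⟨θ, η', h1, h2, h3, h4, h5⟩ := ih
      refine ⟨θ + axisHomotopy i η', axisProj i η', fun F hF => ?_, fun F hF => ?_, ?_,
        fun F => ?_, ?_⟩
      · rw [Pi.add_apply, h1 F hF, zero_add, axisHomotopy]
        split_ifs with hi
        · rfl
        · have : (fun n => η' (F.thickenAt i n)) = fun _ => 0 := by
            funext n
            refine h2 _ fun h => hF ?_
            rw [Face.thickenAt, Finset.card_insert_of_notMem hi] at h
            exact Nat.succ_injective h
          rw [this]
          simp [antideriv]
      · rw [axisProj]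
        split_ifs
        · rfl
        · exact h2 _ hF
      · rw [faceCobd_axisProj, h3]
        funext F
        simp [axisProj]
      · have e := faceCobd_axisHomotopy i η' F
        have e1 : axisHomotopy i (faceCobd η') F = 0 := by
          rw [h3]; simp [axisHomotopy, antideriv]
        have e2 : faceCobd (θ + axisHomotopy i η') F =
            faceCobd θ F + faceCobd (axisHomotopy i η') F := by
          simp only [faceCobd, Pi.add_apply, ← Finset.sum_add_distrib, ← smul_add]
          exact Finset.sum_congr rfl fun j _ => by congr 1; abel
        rw [e1, add_zero] at e
        rw [h4 F, e2, e]; abel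
      · rintro F ⟨j, hj, hjF⟩
        rw [axisProj]
        split_ifs with hi
        · rfl
        · rcases Finset.mem_insert.1 hj with rfl | hj
          · exact absurd hjF hi
          · exact h5 _ ⟨j, hj, hjF⟩
  obtain ⟨θ, η', h1, h2, -, h4, h5⟩ := key Finset.univ
  refine ⟨θ, h1, funext fun F => ?_⟩
  have : η' F = 0 := by
    by_cases hF : F.dirs.card = k + 1
    · obtain ⟨i, hi⟩ := Finset.card_pos.1 (by omega : 0 < F.dirs.card)
      exact h5 F ⟨i, Finset.mem_univ i, hi⟩
    · exact h2 F hF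
  rw [h4 F, this, add_zero]

/-! ### The Poincaré lemma for chains, by duality -/

variable {G : Type*} [AddCommGroup G]

/-- The chain operator with the given values on generators. -/
noncomputable def chainLift {α β : Type*} (φ : α → G →+ (β →₀ G)) : (α →₀ G) →+ (β →₀ G) :=
  Finsupp.liftAddHom φ

theorem chainLift_apply_eq_zero {α β : Type*} {φ : α → G →+ (β →₀ G)} {b : β} {x : α →₀ G}
    (h : ∀ a, x a ≠ 0 → ∀ g, φ a g b = 0) : chainLift φ x b = 0 := by
  change (Finsupp.sum x fun a g => φ a g) b = 0
  rw [Finsupp.sum, Finsupp.finsetSum_apply]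
  exact Finset.sum_eq_zero fun a ha => h a (Finsupp.mem_support_iff.1 ha) _

theorem chainLift_comp {α β γ : Type*} (φ : α → G →+ (β →₀ G)) (T : (β →₀ G) →+ (γ →₀ G)) :
    T.comp (chainLift φ) = chainLift fun a => T.comp (φ a) :=
  Finsupp.addHom_ext fun a g => by simp [chainLift]

/-- Composition with `T`, as a homomorphism. -/
def compLeftHom {A B C : Type*} [AddCommGroup A] [AddCommGroup B] [AddCommGroup C] (T : B →+ C) :
    (A →+ B) →+ (A →+ C) where
  toFun f := T.comp f
  map_zero' := by ext; simp
  map_add' f g := by ext; simp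

/-- Naturality in the coefficients. Since cochains may take values in any abelian group, in
particular in homomorphisms from `G` to chains, this transfers the cochain identities to chains. -/
theorem map_faceCobd (f : M →+ M') (η : Face D → M) (F : Face D) :
    f (faceCobd η F) = faceCobd (fun F => f (η F)) F := by
  simp only [faceCobd, map_sum, map_zsmul, map_sub]

theorem map_axisProj (i : Fin D) (f : M →+ M') (η : Face D → M) (F : Face D) :
    f (axisProj i η F) = axisProj i (fun F => f (η F)) F := by
  unfold axisProj; split_ifs <;> simp

theorem map_axisHomotopy (i : Fin D) (f : M →+ M') (η : Face D → M) (F : Face D) :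
    f (axisHomotopy i η F) = axisHomotopy i (fun F => f (η F)) F := by
  unfold axisHomotopy
  split_ifs
  · simp
  · rw [map_zsmul, map_antideriv]

/-- The universal cochain, with values in chains. -/
noncomputable def univCochain (D : ℕ) (G : Type*) [AddCommGroup G] (F : Face D) :
    G →+ (Face D →₀ G) := Finsupp.singleAddHom F

/-- The cubical boundary operator of `ℝ^D`. -/
noncomputable def faceBdry : (Face D →₀ G) →+ (Face D →₀ G) :=
  chainLift (faceCobd (univCochain D G))

/-- The projection of chains to the hyperplane where the `i`-th coordinate vanishes. -/
noncomputable def chainProj (i : Fin D) : (Face D →₀ G) →+ (Face D →₀ G) :=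
  chainLift (axisProj i (univCochain D G))

/-- The chain homotopy from the identity to `chainProj`. -/
noncomputable def chainHomotopy (i : Fin D) : (Face D →₀ G) →+ (Face D →₀ G) :=
  chainLift (axisHomotopy i (univCochain D G))

/-- The universal property: post-composing the universal cochain with a chain operator returns the
values of the operator on generators. Together with naturality, each identity for chains becomes the
cochain identity for the universal cochain. -/
theorem chainLift_comp_univCochain (φ : Face D → G →+ (Face D →₀ G)) :
    (fun F => compLeftHom (chainLift φ) (univCochain D G F)) = φ := by
  funext F
  refine AddMonoidHom.ext fun g => ?_
  simp [chainLift, compLeftHom, univCochain]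

theorem faceBdry_chainProj (i : Fin D) (x : Face D →₀ G) :
    faceBdry (chainProj i x) = chainProj i (faceBdry x) := by
  have : (faceBdry (G := G)).comp (chainProj i) = (chainProj i).comp faceBdry := by
    rw [faceBdry, chainProj, chainLift_comp, chainLift_comp]
    congr 1
    funext F
    change compLeftHom _ _ = compLeftHom _ _
    rw [map_axisProj, map_faceCobd, chainLift_comp_univCochain, chainLift_comp_univCochain,
      faceCobd_axisProj]
  exact DFunLike.congr_fun this x

theorem faceBdry_chainHomotopy (i : Fin D) (x : Face D →₀ G) :
    faceBdry (chainHomotopy i x) + chainHomotopy i (faceBdry x) = x - chainProj i x := by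
  have : (faceBdry (G := G)).comp (chainHomotopy i) + (chainHomotopy i).comp faceBdry =
      AddMonoidHom.id _ - chainProj i := by
    refine Finsupp.addHom_ext fun F g => ?_
    -- Passing to chains reverses composition: boundary after homotopy corresponds to the cochain
    -- homotopy applied to a coboundary. Hence the `add_comm` below.
    have e1 : faceBdry.comp (axisHomotopy i (univCochain D G) F) =
        axisHomotopy i (faceCobd (univCochain D G)) F := by
      change compLeftHom _ _ = _
      rw [map_axisHomotopy, faceBdry, chainLift_comp_univCochain]
    have e2 : (chainHomotopy i).comp (faceCobd (univCochain D G) F) =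
        faceCobd (axisHomotopy i (univCochain D G)) F := by
      change compLeftHom _ _ = _
      rw [map_faceCobd, chainHomotopy, chainLift_comp_univCochain]
    have e3 := DFunLike.congr_fun (faceCobd_axisHomotopy i (univCochain D G) F) g
    rw [← e1, ← e2, add_comm] at e3
    simpa [chainLift, chainProj, chainHomotopy, faceBdry, univCochain] using e3
  exact DFunLike.congr_fun this x

theorem univCochain_apply_eq_zero {F F' : Face D} (h : F ≠ F') (g : G) :
    univCochain D G F g F' = 0 :=
  Finsupp.single_eq_of_ne h.symm

theorem chainHomotopy_apply_eq_zero (i : Fin D) {k : ℕ} {x : Face D →₀ G}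
    (hx : ∀ F : Face D, F.dirs.card ≠ k → x F = 0) (F : Face D) (hF : F.dirs.card ≠ k + 1) :
    chainHomotopy i x F = 0 := by
  refine chainLift_apply_eq_zero fun E hE g => ?_
  have hEk : E.dirs.card = k := by_contra fun h => hE (hx E h)
  rw [axisHomotopy]
  split_ifs with hi
  · rfl
  · have e : ∀ n, univCochain D G (E.thickenAt i n) g F = 0 := fun n =>
      univCochain_apply_eq_zero (by
        rintro rfl
        exact hF (by rw [Face.thickenAt, Finset.card_insert_of_notMem hi, hEk])) g
    let ev : (G →+ (Face D →₀ G)) →+ G :=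
      (Finsupp.applyAddHom F).comp (AddMonoidHom.eval g)
    change ev (dirSign E.dirs i •
      antideriv (fun n => univCochain D G (E.thickenAt i n)) (E.base i)) = 0
    rw [map_zsmul, map_antideriv]
    have : (fun n => ev (univCochain D G (E.thickenAt i n))) = fun _ => 0 := funext e
    rw [this]
    simp [antideriv]

/-- The projection keeps the directions of a face and kills those containing i. So a restriction `Q`
on directions survives, which lets degree and already eliminated directions be tracked together. -/
theorem chainProj_apply_eq_zero (i : Fin D) {Q : Finset (Fin D) → Prop} {x : Face D →₀ G}
    (hx : ∀ F : Face D, ¬ Q F.dirs → x F = 0) (F : Face D) (hF : ¬ (Q F.dirs ∧ i ∉ F.dirs)) :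
    chainProj i x F = 0 := by
  refine chainLift_apply_eq_zero fun E hE g => ?_
  have hEk : Q E.dirs := by_contra fun h => hE (hx E h)
  rw [axisProj]
  split_ifs with hi
  · rfl
  · refine univCochain_apply_eq_zero ?_ g
    rintro rfl
    exact hF ⟨hEk, hi⟩

/-- The homology of `ℝ^D` vanishes in positive degrees. -/
theorem exists_faceBdry_eq {k : ℕ} {x : Face D →₀ G} (hx : ∀ F, F.dirs.card ≠ k + 1 → x F = 0)
    (hd : faceBdry x = 0) :
    ∃ y : Face D →₀ G, (∀ F, F.dirs.card ≠ k + 2 → y F = 0) ∧ faceBdry y = x := by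
  -- The same elimination of directions, now with the remainder supported on faces of dimension k +
  -- 1 avoiding `T`.
  have key : ∀ T : Finset (Fin D), ∃ y x' : Face D →₀ G, (∀ F, F.dirs.card ≠ k + 2 → y F = 0) ∧
      faceBdry x' = 0 ∧ x = faceBdry y + x' ∧
      ∀ F : Face D, ¬ (F.dirs.card = k + 1 ∧ ∀ i ∈ T, i ∉ F.dirs) → x' F = 0 := by
    intro T
    induction T using Finset.induction_on with
    | empty => exact ⟨0, x, fun _ _ => rfl, hd, by simp, fun F hF => hx F (by simpa using hF)⟩
    | insert i T _ ih =>
      obtain ⟨y, x', h1, h2, h3, h4⟩ := ih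
      refine ⟨y + chainHomotopy i x', chainProj i x', fun F hF => ?_, ?_, ?_, fun F hF => ?_⟩
      · rw [Finsupp.add_apply, h1 F hF, zero_add]
        exact chainHomotopy_apply_eq_zero i (fun E hE => h4 E fun h => hE h.1) F hF
      · rw [faceBdry_chainProj, h2, map_zero]
      · have e := faceBdry_chainHomotopy i x'
        rw [h2, map_zero, add_zero] at e
        rw [map_add, e, h3]; abel
      · refine chainProj_apply_eq_zero i
          (Q := fun U => U.card = k + 1 ∧ ∀ i ∈ T, i ∉ U) h4 F fun h => hF ⟨h.1.1, fun j hj => ?_⟩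
        rcases Finset.mem_insert.1 hj with rfl | hj
        · exact h.2
        · exact h.1.2 j hj
  obtain ⟨y, x', h1, -, h3, h4⟩ := key Finset.univ
  have : x' = 0 := by
    ext F
    refine h4 F fun h => ?_
    obtain ⟨i, hi⟩ := Finset.card_pos.1 (by omega : 0 < F.dirs.card)
    exact h.2 i (Finset.mem_univ i) hi
  exact ⟨y, h1, by rw [h3, this, add_zero]⟩

/-! #### The region `ℝ^D` -/

variable {Y : Set (Lattice D)}

theorem face_mem_univ (hY : Y = univ) (F : Face D) : ∃ z ∈ cubesIn Y, F.InCube z :=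
  ⟨F.base, by subst hY; exact subset_univ _, fun _ => Or.inl rfl⟩

theorem regionComplex_cocycles_le (hY : Y = univ) (k : ℕ) :
    (regionComplex Y).cocycles G (k + 1) ≤ (regionComplex Y).coboundaries G (k + 1) := by
  rintro η ⟨h1, h2⟩
  have hd : (regionComplex Y).coboundary G η = 0 := h2
  obtain ⟨θ, h3, h4⟩ := exists_faceCobd_eq (k := k)
    (η := fun F : Face D => η ⟨F, face_mem_univ hY F⟩) (fun F hF => h1 ⟨F, _⟩ hF)
    (funext fun F => congrFun hd ⟨F, face_mem_univ hY F⟩)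
  exact ⟨fun c => θ c.1, fun c hc => h3 c.1 hc, funext fun c => congrFun h4 c.1⟩

theorem regionComplex_cycles_le (hY : Y = univ) (k : ℕ) :
    (regionComplex Y).cycles G (k + 1) ≤ (regionComplex Y).boundaries G (k + 1) := by
  rintro x ⟨h1, h2⟩
  have hd : (regionComplex Y).boundary G x = 0 := h2
  let e : (regionComplex Y).Cell ≃ Face D :=
    ⟨fun c => c.1, fun F => ⟨F, face_mem_univ hY F⟩, fun _ => rfl, fun _ => rfl⟩
  have hb : ∀ y : Face D →₀ G, (regionComplex Y).boundary G (Finsupp.mapDomain e.symm y) =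
      Finsupp.mapDomain e.symm (faceBdry y) := by
    intro y
    have : ((regionComplex Y).boundary G).comp (Finsupp.mapDomain.addMonoidHom e.symm) =
        (Finsupp.mapDomain.addMonoidHom e.symm).comp faceBdry := by
      refine Finsupp.addHom_ext fun F g => ?_
      simp only [AddMonoidHom.comp_apply, CubicalComplex.boundary, faceBdry, chainLift, faceCobd,
        Finsupp.mapDomain.addMonoidHom_apply, Finsupp.mapDomain_single,
        Finsupp.liftAddHom_apply_single, AddMonoidHom.finsetSum_apply, AddMonoidHom.smul_apply,
        AddMonoidHom.sub_apply, Finsupp.singleAddHom_apply, univCochain]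
      rw [← Finsupp.mapDomain.addMonoidHom_apply, map_sum]
      refine Finset.sum_congr rfl fun i _ => ?_
      rw [map_zsmul, map_sub]
      simp only [Finsupp.mapDomain.addMonoidHom_apply, Finsupp.mapDomain_single]
      rfl
    exact DFunLike.congr_fun this y
  have hx : Finsupp.mapDomain e.symm (Finsupp.mapDomain e x) = x := by
    rw [← Finsupp.mapDomain_comp]
    exact Finsupp.mapDomain_id
  obtain ⟨y, h3, h4⟩ := exists_faceBdry_eq (k := k) (x := Finsupp.mapDomain e x)
    (fun F hF => by
      rw [← e.apply_symm_apply F, Finsupp.mapDomain_apply e.injective]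
      exact h1 _ hF)
    (Finsupp.mapDomain_injective e.symm.injective (by rw [← hb, hx, hd, Finsupp.mapDomain_zero]))
  refine ⟨Finsupp.mapDomain e.symm y, fun c hc => ?_, by rw [hb, h4, hx]⟩
  rw [← e.symm_apply_apply c, Finsupp.mapDomain_apply e.symm.injective]
  exact h3 _ hc

theorem regionComplex_cohomology_eq_zero (hY : Y = univ) {k : ℕ} (hk : 1 ≤ k)
    (x : (regionComplex Y).Cohomology G k) : x = 0 := by
  obtain ⟨k, rfl⟩ := Nat.exists_eq_add_of_le' hk
  induction x using QuotientAddGroup.induction_on with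
  | H x => exact (QuotientAddGroup.eq_zero_iff x).2 (regionComplex_cocycles_le hY k x.2)

theorem regionComplex_homology_eq_zero (hY : Y = univ) {k : ℕ} (hk : 1 ≤ k)
    (x : (regionComplex Y).Homology G k) : x = 0 := by
  obtain ⟨k, rfl⟩ := Nat.exists_eq_add_of_le' hk
  induction x using QuotientAddGroup.induction_on with
  | H x => exact (QuotientAddGroup.eq_zero_iff x).2 (regionComplex_cycles_le hY k x.2)

end Poincare

/-! ### Persistence of (co)homology defects -/

section Persistence

variable {D : ℕ} {A : Type u} {S : Set (Config D A)}

theorem blockAt_image {Φ : Config D A → Config D A} {q : ℕ} (hq : HasRadius Φ q)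
    {a c : Config D A} {r : ℕ} {z w : Lattice D} (h : blockAt a (r + q) z = blockAt c (r + q) w) :
    blockAt (Φ a) r z = blockAt (Φ c) r w := by
  refine funext fun x => hq _ _ _ _ fun y hy => ?_
  have := congrFun h ⟨x + y, box_add x.2 hy⟩
  simpa [blockAt, add_assoc] using this

/-- A defect spreads by at most q under Φ. The induced inclusions compare the domains of the
signatures of `a` and Φ a. -/
theorem unflawed_subset_image {Φ : Config D A → Config D A} {q : ℕ} (hq : HasRadius Φ q)
    (hS : MapsTo Φ S S) (a : Config D A) (r : ℕ) :
    unflawed S a (r + q) ⊆ unflawed S (Φ a) r := by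
  rintro z ⟨c, hc, h⟩
  exact ⟨Φ c, hS hc, blockAt_image hq h⟩

theorem caMap_tileAt {Φ : Config D A → Config D A} {q : ℕ} (hq : HasRadius Φ q)
    (hS : MapsTo Φ S S) (a : Config D A) (r : ℕ) {z : Lattice D} (hz : z ∈ unflawed S a (r + q)) :
    (caMap hq hS r).toFun ⟨blockAt a (r + q) z, hz⟩ =
      ⟨blockAt (Φ a) r z, unflawed_subset_image hq hS a r hz⟩ := by
  refine Subtype.ext (blockAt_image hq ?_)
  exact Exists.choose_spec hz |>.2

theorem mem_slightlyDefective_iff {a : Config D A} :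
    a ∈ slightlyDefective S ↔ ∀ r, (unflawed S a r).Nonempty := by
  constructor
  · intro h r
    -- The radius is raised by one because the defect field detects admissible blocks only at
    -- positive radii.
    have h1 : ((r + 1 : ℕ) : ℕ∞) < ⨆ z, defectField S a z := by
      rw [show ⨆ z, defectField S a z = ⊤ from h]
      exact ENat.natCast_lt_top _
    obtain ⟨z, hz⟩ := lt_iSup_iff.1 h1
    exact ⟨z, unflawed_anti S a r.le_succ ((le_defectField_iff S a z r.succ_pos).1 hz.le)⟩
  · intro h
    refine ENat.eq_top_iff_forall_ge.2 fun r => ?_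
    obtain ⟨z, hz⟩ := h (r + 1)
    refine le_trans ?_ (le_iSup _ z)
    refine le_trans ?_ ((le_defectField_iff S a z r.succ_pos).2 hz)
    exact_mod_cast r.le_succ

theorem image_mem_slightlyDefective {Φ : Config D A → Config D A} {q : ℕ} (hq : HasRadius Φ q)
    (hS : MapsTo Φ S S) {a : Config D A} (ha : a ∈ slightlyDefective S) :
    Φ a ∈ slightlyDefective S :=
  mem_slightlyDefective_iff.2 fun r =>
    (mem_slightlyDefective_iff.1 ha (r + q)).mono (unflawed_subset_image hq hS a r)

theorem shift_mem (hS : ∀ v, shift v '' S = S) {a : Config D A} (ha : a ∈ S) (v : Lattice D) :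
    shift v a ∈ S := by
  rw [← hS v]
  exact mem_image_of_mem _ ha

theorem unflawed_eq_univ (hS : ∀ v, shift v '' S = S) {a : Config D A} (ha : a ∈ S) (r : ℕ) :
    unflawed S a r = univ := by
  refine eq_univ_of_forall fun z => ⟨shift z a, shift_mem hS ha z, ?_⟩
  funext x
  simp [blockAt, shift, add_comm]

/-- The naturality square. Labels in one cube agree by locality of Φ; the two sides may select
different cubes containing the face, and `cellAt_eq` removes this choice. -/
theorem caMap_sectionHom {Φ : Config D A → Config D A} {q : ℕ} (hq : HasRadius Φ q)
    (hS : MapsTo Φ S S) (a : Config D A) (r : ℕ)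
    (c : (regionComplex (unflawed S a (r + q))).Cell) :
    (caMap hq hS r).cellMap.toFun ((sectionHom S a (r + q)).toFun c) =
      (sectionHom S (Φ a) r).toFun ((regionIncl (unflawed_subset_image hq hS a r)).toFun c) := by
  have h := cellAt_eq (Φ a) r c.1
    (cubesIn_mono (unflawed_subset_image hq hS a r) c.2.choose_spec.1)
    ((regionIncl (unflawed_subset_image hq hS a r)).toFun c).2.choose_spec.1 c.2.choose_spec.2
    ((regionIncl (unflawed_subset_image hq hS a r)).toFun c).2.choose_spec.2
  refine Eq.trans ?_ h
  have e := caMap_tileAt hq hS a r (cubesIn_subset _ c.2.choose_spec.1)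
  change Quot.mk _ (⟨((_, (caMap hq hS r).toFun ⟨blockAt a (r + q) c.2.choose, _⟩), c.1), _⟩ :
    {x : Tile S r × Face D // x.2.InCube x.1.1}) = _
  rw [e]
  rfl

theorem caMap_sectionMap {Φ : Config D A → Config D A} {q : ℕ} (hq : HasRadius Φ q)
    (hS : MapsTo Φ S S) (a : Config D A) (r : ℕ) (p : thicken (unflawed S a (r + q))) :
    (caMap hq hS r).spaceMap (sectionMap S a (r + q) p) =
      sectionMap S (Φ a) r ⟨p.1, thicken_mono (unflawed_subset_image hq hS a r) p.2⟩ := by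
  obtain ⟨z, hz, hp⟩ := p.2
  rw [sectionMap_apply a (r + q) p hz hp,
    sectionMap_apply (Φ a) r _ (cubesIn_mono (unflawed_subset_image hq hS a r) hz) hp]
  have e := caMap_tileAt hq hS a r (cubesIn_subset _ hz)
  change Quot.mk _ (⟨(z, (caMap hq hS r).toFun ⟨blockAt a (r + q) z, _⟩), ⟨p.1, hp⟩⟩ :
    Σ t : Tile S r, unitCube t.1) = _
  rw [e]
  rfl

/-! ### One step of Φ on homology and cohomology defects -/

variable (G : Type w) [AddCommGroup G] {k : ℕ}

/-- For an element of `S` the regions are all of ℝ^D, so the signature starts from a vanishing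
group. -/
theorem not_mem_of_homologyDefect (hS : ∀ v, shift v '' S = S) (hk : 1 ≤ k) {a : Config D A}
    (h : HasHomologyDefect S G k a) : a ∉ S := by
  intro ha
  refine h.2 (AddMonoidHom.ext fun u => Subtype.ext (funext fun r => ?_))
  change (sectionHom S a r).homologyMap G k (u.1 r) = 0
  rw [regionComplex_homology_eq_zero (unflawed_eq_univ hS ha r) hk (u.1 r), map_zero]

/-- By naturality Φ sends the signature of `a` at u to the signature of Φ a at the pushforward of u.
If the latter vanishes for all u, injectivity kills the former. -/
theorem HasHomologyDefect.image {Φ : Config D A → Config D A} {q : ℕ} (hq : HasRadius Φ q)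
    (hS : MapsTo Φ S S) (hinj : Function.Injective (projHomologyMap G k hq hS)) {a : Config D A}
    (h : HasHomologyDefect S G k a) : HasHomologyDefect S G k (Φ a) := by
  refine ⟨image_mem_slightlyDefective hq hS h.1, fun h0 => h.2 (AddMonoidHom.ext fun u => ?_)⟩
  refine hinj ?_
  rw [AddMonoidHom.zero_apply, map_zero]
  -- The pushforward of u along the inclusions of G_(r+q)(a) in G_r(Φ a); compatibility is that of
  -- inclusions.
  let u' : RegionHomology S G k (Φ a) :=
    ⟨fun r => (regionIncl (unflawed_subset_image hq hS a r)).homologyMap G k (u.1 (r + q)),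
      fun r s h => (CubicalComplex.Hom.homologyMap_square
        (regionIncl (unflawed_subset_image hq hS a s)) (regionIncl (unflawed_anti S (Φ a) h))
        (regionIncl (unflawed_anti S a (Nat.add_le_add_right h q)))
        (regionIncl (unflawed_subset_image hq hS a r)) (fun _ => rfl) _ _).trans
        (congrArg _ (u.2 _ _ (Nat.add_le_add_right h q)))⟩
  have e := DFunLike.congr_fun h0 u'
  refine Subtype.ext (funext fun r => ?_)
  have e1 : (sectionHom S (Φ a) r).homologyMap G k (u'.1 r) = 0 :=
    congrFun (congrArg Subtype.val e) r
  refine Eq.trans ?_ e1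
  exact CubicalComplex.Hom.homologyMap_square _ _ _ _ (caMap_sectionHom hq hS a r) _ _

theorem not_mem_of_cohomologyDefect (hS : ∀ v, shift v '' S = S) (hk : 1 ≤ k) {a : Config D A}
    (h : HasCohomologyDefect S G k a) : a ∉ S := by
  intro ha
  refine h.2 (AddCommGroup.DirectLimit.hom_ext _ fun r => AddMonoidHom.ext fun x => ?_)
  change cohomologySignature S G k a (AddCommGroup.DirectLimit.of _ _ r x) = 0
  unfold cohomologySignature
  rw [AddCommGroup.DirectLimit.map_apply_of,
    regionComplex_cohomology_eq_zero (unflawed_eq_univ hS ha r) hk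
      ((sectionHom S a r).cohomologyMap G k x), map_zero]

/-- The dual factorization: signature of `a` after Φ equals restriction after the signature of Φ a.
Surjectivity of Φ allows the right factor on the left-hand side to be cancelled. -/
theorem HasCohomologyDefect.image {Φ : Config D A → Config D A} {q : ℕ} (hq : HasRadius Φ q)
    (hS : MapsTo Φ S S) (hsurj : Function.Surjective (projCohomologyMap G k hq hS))
    {a : Config D A} (h : HasCohomologyDefect S G k a) : HasCohomologyDefect S G k (Φ a) := by
  refine ⟨image_mem_slightlyDefective hq hS h.1, fun h0 => h.2 ?_⟩
  -- Restriction of classes from G_r(Φ a) to G_(r+q)(a), in the direct limit.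
  let ι : RegionCohomology S G k (Φ a) →+ RegionCohomology S G k a :=
    AddCommGroup.DirectLimit.lift _ _ _
      (fun r => (AddCommGroup.DirectLimit.of _ _ (r + q)).comp
        ((regionIncl (unflawed_subset_image hq hS a r)).cohomologyMap G k))
      fun r s h x => by
        simp only [AddMonoidHom.comp_apply]
        rw [CubicalComplex.Hom.cohomologyMap_square
          (regionIncl (unflawed_subset_image hq hS a s)) (regionIncl (unflawed_anti S (Φ a) h))
          (regionIncl (unflawed_anti S a (Nat.add_le_add_right h q)))
          (regionIncl (unflawed_subset_image hq hS a r)) (fun _ => rfl)]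
        exact AddCommGroup.DirectLimit.of_f (Nat.add_le_add_right h q) _
  have key : (cohomologySignature S G k a).comp (projCohomologyMap G k hq hS) =
      ι.comp (cohomologySignature S G k (Φ a)) := by
    refine AddCommGroup.DirectLimit.hom_ext _ fun r => AddMonoidHom.ext fun x => ?_
    simp only [AddMonoidHom.comp_apply, projCohomologyMap, cohomologySignature, ι,
      AddCommGroup.DirectLimit.lift_of, AddCommGroup.DirectLimit.map_apply_of]
    congr 1
    exact CubicalComplex.Hom.cohomologyMap_square _ _ _ _ (caMap_sectionHom hq hS a r) _ _
  refine AddMonoidHom.ext fun x => ?_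
  obtain ⟨y, rfl⟩ := hsurj x
  have := DFunLike.congr_fun key y
  rw [AddMonoidHom.comp_apply, AddMonoidHom.comp_apply, h0, AddMonoidHom.zero_apply,
    map_zero] at this
  rw [this, AddMonoidHom.zero_apply]

theorem isPersistent_of_step {P : Config D A → Prop} {Φ : Config D A → Config D A}
    (h1 : ∀ a, P a → a ∈ slightlyDefective S) (h2 : ∀ a, P a → a ∉ S)
    (h3 : ∀ a, P a → P (Φ a)) {a : Config D A} (ha : P a) : IsPersistent S Φ a := by
  intro t
  have : P (Φ^[t] a) := by
    induction t with
    | zero => exact ha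
    | succ t ih => rw [Function.iterate_succ_apply']; exact h3 _ ih
  exact ⟨h1 _ this, h2 _ this⟩

end Persistence

/-! ### Homotopy classes along rays -/

section Rays

variable {X : Type u} [TopologicalSpace X] {Y : Type v} [TopologicalSpace Y] {k : ℕ}

theorem FreelyHomotopic.of_eq {x y : X} (hxy : x = y) {f : GenLoop (Fin k) X x}
    {g : GenLoop (Fin k) X y} (h : ∀ p, f p = g p) : FreelyHomotopic f g := by
  subst hxy
  rw [GenLoop.ext f g h]
  exact .refl g

theorem mapLoop_const (f : C(X, Y)) {x : X} {y : Y} (h : f x = y) :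
    mapLoop f h (GenLoop.const : GenLoop (Fin k) X x) = GenLoop.const :=
  GenLoop.ext _ _ fun _ => h

theorem mapLoop_homotopic (f : C(X, Y)) {x : X} {y : Y} (h : f x = y) {g g' : GenLoop (Fin k) X x}
    (hg : GenLoop.Homotopic g g') : GenLoop.Homotopic (mapLoop f h g) (mapLoop f h g') :=
  hg.comp_continuousMap f

/-- The track is an affine segment of parameters. It stays above the smaller endpoint, hence inside
the upper set on which the ray is defined, and so gives an honest path. -/
theorem RayRel.freelyHomotopic {ρ : Ray Y} {x y : Σ t : ρ.dom, GenLoop (Fin k) Y (ρ.pt t)}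
    (h : RayRel k ρ x y) : FreelyHomotopic x.2 y.2 := by
  obtain ⟨H, h0, h1, hb⟩ := h
  let τ : I → ℝ≥0 := fun s =>
    unitInterval.toNNReal (σ s) * x.1.1 + unitInterval.toNNReal s * y.1.1
  have hτ : Continuous τ := by fun_prop
  have hmem : ∀ s, τ s ∈ ρ.dom := by
    intro s
    have hs : unitInterval.toNNReal (σ s) + unitInterval.toNNReal s = 1 :=
      unitInterval.toNNReal_symm_add_toNNReal s
    have hmin : min x.1.1 y.1.1 ∈ ρ.dom := by
      rcases min_choice x.1.1 y.1.1 with h | h <;> rw [h]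
      exacts [x.1.2, y.1.2]
    refine ρ.upper ?_ hmin
    calc min x.1.1 y.1.1
        = (unitInterval.toNNReal (σ s) + unitInterval.toNNReal s) * min x.1.1 y.1.1 := by
          rw [hs, one_mul]
      _ = unitInterval.toNNReal (σ s) * min x.1.1 y.1.1
          + unitInterval.toNNReal s * min x.1.1 y.1.1 := add_mul _ _ _
      _ ≤ τ s := add_le_add (mul_le_mul_right (min_le_left _ _) _)
          (mul_le_mul_right (min_le_right _ _) _)
  have e0 : (⟨τ 0, hmem 0⟩ : ρ.dom) = x.1 := Subtype.ext (by simp [τ])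
  have e1 : (⟨τ 1, hmem 1⟩ : ρ.dom) = y.1 := Subtype.ext (by simp [τ])
  refine ⟨⟨⟨fun s => ρ.pt ⟨τ s, hmem s⟩, ρ.continuous_pt.comp (hτ.subtype_mk hmem)⟩,
    congrArg ρ.pt e0, congrArg ρ.pt e1⟩, H, h0, h1, fun s p hp => ?_⟩
  exact hb s p hp ⟨τ s, hmem s⟩ (by simp [τ])

/-- Free homotopy is an equivalence relation, so it contains the one generated by `RayRel`. It
forgets the ray, but still detects triviality. -/
theorem RayPi.freelyHomotopic {ρ : Ray Y} {x y : Σ t : ρ.dom, GenLoop (Fin k) Y (ρ.pt t)}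
    (h : (Quot.mk _ x : RayPi k Y ρ) = Quot.mk _ y) : FreelyHomotopic x.2 y.2 := by
  have h' := Quot.eqvGen_exact h
  clear h
  induction h' with
  | rel _ _ h => exact RayRel.freelyHomotopic h
  | refl x => exact .refl x.2
  | symm _ _ _ ih => exact ih.symm
  | trans _ _ _ _ _ ih1 ih2 => exact ih1.trans ih2

theorem RayPi.isOne_of_homotopic {ρ : Ray Y} {t : ρ.dom} {g : GenLoop (Fin k) Y (ρ.pt t)}
    (h : GenLoop.Homotopic g GenLoop.const) : RayPi.IsOne (Quot.mk _ ⟨t, g⟩ : RayPi k Y ρ) := by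
  obtain ⟨H⟩ := h
  refine ⟨t, Quot.sound ⟨H.toContinuousMap, H.apply_zero, H.apply_one, fun s p hp t' ht' => ?_⟩⟩
  -- Both ends of the segment are t, so t is the only parameter that occurs.
  have e : t' = t := Subtype.ext (NNReal.coe_injective (ht'.trans (by simp; ring)))
  rw [e]
  exact (H.prop s p hp).trans (GenLoop.boundary g p hp)

end Rays

/-! ### Sections, and the connectedness of the tile spaces -/

section Connected

variable {D : ℕ} {A : Type u} {S : Set (Config D A)}

theorem mk_tile_congr {r : ℕ} {z : Lattice D} {b b' : Adm S r} (h : b.1 = b'.1)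
    (p : unitCube z) : (Quot.mk _ ⟨(z, b), p⟩ : TileSpace S r) = Quot.mk _ ⟨(z, b'), p⟩ := by
  rw [Subtype.ext h]

theorem mem_thicken_of_mem (hS : ∀ v, shift v '' S = S) {a : Config D A} (ha : a ∈ S) (r : ℕ)
    (p : Fin D → ℝ) : p ∈ thicken (unflawed S a r) := by
  rw [unflawed_eq_univ hS ha]
  exact ⟨fun i => ⌊p i⌋, subset_univ _, fun i => ⟨Int.floor_le _, (Int.lt_floor_add_one _).le⟩⟩

/-- The section of `X_r → ℝ^D` determined by an element of the subshift. -/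
noncomputable def fullSection (hS : ∀ v, shift v '' S = S) (c : S) (r : ℕ) :
    C(Fin D → ℝ, TileSpace S r) :=
  (sectionMap S c.1 r).comp ⟨fun p => ⟨p, mem_thicken_of_mem hS c.2 r p⟩, by fun_prop⟩

theorem fullSection_apply (hS : ∀ v, shift v '' S = S) (c : S) (r : ℕ) {p : Fin D → ℝ}
    {z : Lattice D} (hp : p ∈ unitCube z) (hz : z ∈ unflawed S c.1 r) :
    fullSection hS c r p = Quot.mk _ ⟨(z, ⟨blockAt c.1 r z, hz⟩), ⟨p, hp⟩⟩ :=
  sectionMap_apply c.1 r _ (by rw [unflawed_eq_univ hS c.2]; exact subset_univ _) hp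

/-- A label is a block of some element of `S`, and a translate of that element shows the block at
the given cube. Thus X_r is covered by copies of ℝ^D, one for each element of `S`. -/
theorem exists_fullSection_eq (hS : ∀ v, shift v '' S = S) {r : ℕ} (y : TileSpace S r) :
    ∃ (c : S) (p : Fin D → ℝ), fullSection hS c r p = y := by
  induction y using Quot.ind with
  | mk y =>
    obtain ⟨⟨z, ⟨b, hb⟩⟩, ⟨p, hp⟩⟩ := y
    obtain ⟨d, hd, rfl⟩ := hb
    refine ⟨⟨shift (-z) d, shift_mem hS hd _⟩, p, ?_⟩
    have hz : z ∈ unflawed S (shift (-z) d) r := by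
      rw [unflawed_eq_univ hS (shift_mem hS hd _)]; trivial
    rw [fullSection_apply hS _ r hp hz]
    have e : blockAt (shift (-z) d) r z = blockAt d r 0 := by
      funext x
      simp only [blockAt, shift]
      congr 1; abel
    exact mk_tile_congr e ⟨p, hp⟩

theorem fullSection_zero (hS : ∀ v, shift v '' S = S) (c : S) (r : ℕ) :
    fullSection hS c r 0 = basePt c r :=
  fullSection_apply hS c r (fun i => by simp) _

theorem joined_fullSection (hS : ∀ v, shift v '' S = S) (c : S) (r : ℕ) (p p' : Fin D → ℝ) :
    Joined (fullSection hS c r p) (fullSection hS c r p') :=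
  (PathConnectedSpace.joined p p').map (fullSection hS c r).continuous

/-! ### Path connectedness of X_r under weak mixing -/

theorem finite_box (D r : ℕ) : (box D r).Finite := by
  refine (Set.finite_Icc (fun _ => -(r : ℤ)) (fun _ => (r : ℤ))).subset fun x hx => ?_
  exact ⟨fun i => (abs_le.1 (hx i)).1, fun i => (abs_le.1 (hx i)).2⟩

theorem isOpen_blockAt [TopologicalSpace A] [DiscreteTopology A] (r : ℕ) (b : Block D A r) :
    IsOpen {a : Config D A | blockAt a r 0 = b} := by
  have := (finite_box D r).to_subtype
  have hc : Continuous fun a : Config D A => blockAt a r 0 :=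
    continuous_pi fun x => continuous_apply _
  exact (isOpen_discrete {b}).preimage hc

/-- Weak mixing provides e and e' in `S` with the central blocks of c and d at 0 and with one common
block at some z. Over z their sections agree, so one walks out along the section of e and back along
that of e'. -/
theorem joined_basePt [TopologicalSpace A] [DiscreteTopology A] (hS : ∀ v, shift v '' S = S)
    (hw : IsWeaklyMixing S) (r : ℕ) (c d : S) : Joined (basePt c r) (basePt d r) := by
  let V : Block D A r → Block D A r → Set (Config D A × Config D A) := fun b b' =>
    {a | blockAt a r 0 = b} ×ˢ {a | blockAt a r 0 = b'}
  have hV : ∀ b b', IsOpen (V b b') := fun b b' => (isOpen_blockAt r b).prod (isOpen_blockAt r b')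
  obtain ⟨z, -, ⟨⟨e, e'⟩, ⟨⟨he, he'⟩, heS, heS'⟩, rfl⟩, ⟨hz, hz'⟩, -⟩ :=
    hw (V (blockAt c.1 r 0) (blockAt d.1 r 0)) (V (blockAt c.1 r 0) (blockAt c.1 r 0))
      (hV _ _) (hV _ _) ⟨(c.1, d.1), ⟨rfl, rfl⟩, c.2, d.2⟩ ⟨(c.1, c.1), ⟨rfl, rfl⟩, c.2, c.2⟩
  have hbase : ∀ f f' : S, blockAt f.1 r 0 = blockAt f'.1 r 0 → basePt f r = basePt f' r :=
    fun f f' h => mk_tile_congr h _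
  have hsh : ∀ a : Config D A, blockAt (shift z a) r 0 = blockAt a r z := fun a => by
    funext x
    simp only [blockAt, shift]
    congr 1; abel
  have hcorner : (fun i => (z i : ℝ)) ∈ unitCube z := fun i => ⟨le_rfl, by simp⟩
  have hmid : fullSection hS ⟨e, heS⟩ r (fun i => (z i : ℝ)) =
      fullSection hS ⟨e', heS'⟩ r (fun i => (z i : ℝ)) := by
    have h1 : blockAt e r z = blockAt e' r z :=
      ((hsh e).symm.trans hz).trans ((hsh e').symm.trans hz').symm
    rw [fullSection_apply hS _ r hcorner (by rw [unflawed_eq_univ hS heS]; trivial),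
      fullSection_apply hS _ r hcorner (by rw [unflawed_eq_univ hS heS']; trivial)]
    exact mk_tile_congr h1 _
  have h1 := joined_fullSection hS ⟨e, heS⟩ r 0 (fun i => (z i : ℝ))
  have h2 := joined_fullSection hS ⟨e', heS'⟩ r (fun i => (z i : ℝ)) 0
  rw [fullSection_zero, hbase ⟨e, heS⟩ c he] at h1
  rw [fullSection_zero, hbase ⟨e', heS'⟩ d he', ← hmid] at h2
  exact h1.trans h2

theorem joined_basePt_point [TopologicalSpace A] [DiscreteTopology A]
    (hS : ∀ v, shift v '' S = S) (hw : IsWeaklyMixing S) {r : ℕ} (c : S) (y : TileSpace S r) :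
    Joined (basePt c r) y := by
  obtain ⟨d, p, rfl⟩ := exists_fullSection_eq hS y
  refine (joined_basePt hS hw r c d).trans ?_
  rw [← fullSection_zero hS]
  exact joined_fullSection hS d r 0 p

/-! ### Subshifts with at most one element -/

/-- The projection `X_r → ℝ^D`. -/
def tileProj (S : Set (Config D A)) (r : ℕ) : C(TileSpace S r, Fin D → ℝ) where
  toFun := Quot.lift (fun x => x.2.1) fun _ _ h => h.2
  continuous_toFun := continuous_quot_lift _ (continuous_sigma fun _ => continuous_subtype_val)

theorem tileProj_fullSection (hS : ∀ v, shift v '' S = S) (c : S) (r : ℕ) (p : Fin D → ℝ) :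
    tileProj S r (fullSection hS c r p) = p := by
  rw [fullSection_apply hS c r (z := fun i => ⌊p i⌋)
    (fun i => ⟨Int.floor_le _, (Int.lt_floor_add_one _).le⟩)
    (by rw [unflawed_eq_univ hS c.2]; trivial)]
  rfl

/-- A single section covers X_r, so it is inverse to the projection and X_r is a copy of ℝ^D. -/
theorem homotopic_const_of_subsingleton (hS : ∀ v, shift v '' S = S) (hsub : S.Subsingleton)
    (c : S) {k r : ℕ} {y : TileSpace S r} (f : GenLoop (Fin k) (TileSpace S r) y) :
    GenLoop.Homotopic f GenLoop.const := by
  refine homotopic_const_of_retract (tileProj S r) (fullSection hS c r) (fun x => ?_) f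
  obtain ⟨d, p, rfl⟩ := exists_fullSection_eq hS x
  rw [tileProj_fullSection, Subtype.ext (hsub c.2 d.2)]

/-- The base vertex of a face exceeds that of its cube by 0 or 1 in each coordinate. From radius 1
on, the label of the cube therefore shows the symbol at that vertex. -/
theorem Face.InCube.sub_mem_box {F : Face D} {z : Lattice D} (h : F.InCube z) {r : ℕ}
    (hr : 1 ≤ r) : F.base - z ∈ box D r := by
  intro i
  have h1 : (1 : ℤ) ≤ r := by exact_mod_cast hr
  rw [Pi.sub_apply, abs_le]
  rcases h i with h | ⟨-, h⟩ <;> rw [h] <;> constructor <;> linarith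

/-- The symbol at the base point of a cell of `X_r`. -/
def cellLabel (S : Set (Config D A)) {r : ℕ} (hr : 1 ≤ r) : (tileComplex S r).Cell → A :=
  Quot.lift (fun x => x.1.1.2.1 ⟨x.1.2.base - x.1.1.1, x.2.sub_mem_box hr⟩) (by
    rintro ⟨⟨⟨z, b⟩, F⟩, hF⟩ ⟨⟨⟨z', b'⟩, F'⟩, hF'⟩ ⟨⟨d, hz, hm⟩, rfl : F = F'⟩
    have hz : z' = z + unitVec d := hz
    subst hz
    have e : F.base - z = F.base - (z + unitVec d) + unitVec d := by abel
    have h1 := hm (F.base - (z + unitVec d)) (hF'.sub_mem_box hr)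
      (by rw [← e]; exact hF.sub_mem_box hr)
    refine Eq.trans ?_ h1
    exact congrArg b.1 (Subtype.ext e))

/-- A vertex of X_r remembers the symbol at its position. If only one vertex lies over 0, all
elements of `S` agree at 0, and by shift invariance everywhere. -/
theorem subsingleton_of_vertexInjective (hS : ∀ v, shift v '' S = S) {r : ℕ} (hr : 1 ≤ r)
    (h : VertexInjective S r) : S.Subsingleton := by
  have h0 : ∀ c ∈ S, ∀ c' ∈ S, c 0 = c' 0 := by
    intro c hc c' hc'
    let cell : ∀ c ∈ S, (tileComplex S r).Cell := fun c hc =>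
      Quot.mk _ ⟨((0, ⟨blockAt c r 0, c, hc, rfl⟩), ⟨0, ∅⟩), fun i => Or.inl rfl⟩
    have e := congrArg (cellLabel S hr) (h (cell c hc) (cell c' hc') rfl rfl rfl)
    change blockAt c r 0 _ = blockAt c' r 0 _ at e
    simpa [blockAt] using e
  intro c hc c' hc'
  funext z
  simpa [shift] using h0 _ (shift_mem hS hc z) _ (shift_mem hS hc' z)

end Connected

/-! ### Persistence of homotopy defects -/

section HomotopyDefects

variable {D : ℕ} {A : Type u} {S : Set (Config D A)} {k : ℕ}

/-- Freely homotopic `k`-dimensional loops at `x_s(c)` have homotopic images in `X_r`. -/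
def CollapsesFree (k : ℕ) (c : S) {r s : ℕ} (h : r ≤ s) : Prop :=
  ∀ f g : GenLoop (Fin k) (TileSpace S s) (basePt c s), FreelyHomotopic f g →
    GenLoop.Homotopic (mapLoop (restrictMap S h).spaceMap (restrict_basePt c h) f)
      (mapLoop (restrictMap S h).spaceMap (restrict_basePt c h) g)

theorem piOneMap_mk (c : S) {r s : ℕ} (h : r ≤ s) (γ : Path (basePt c s) (basePt c s)) :
    piOneMap c h (FundamentalGroup.fromPath (.mk γ)) =
      FundamentalGroup.fromPath (.mk ((γ.map (restrictMap S h).spaceMap.continuous).cast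
        (restrict_basePt c h).symm (restrict_basePt c h).symm)) := by
  rw [piOneMap, FundamentalGroup.mapOfEq_apply]
  rfl

/-- The track of a free homotopy between loops at one point is itself a loop, and its image below is
null-homotopic. -/
theorem collapsesFree_of_trivial (c : S) {r s : ℕ} (h : r ≤ s) (ht : ∀ u, piOneMap c h u = 1) :
    CollapsesFree k c h := by
  rintro f g ⟨γ, hγ⟩
  refine (hγ.map (restrictMap S h).spaceMap (restrict_basePt c h) (restrict_basePt c h)).homotopic
    ?_
  have := ht (FundamentalGroup.fromPath (.mk γ))
  rw [piOneMap_mk] at this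
  exact Path.Homotopic.Quotient.exact this

/-- In dimension one, freely homotopic loops are conjugate, and conjugate elements have the same
image when the images commute. -/
theorem collapsesFree_of_comm (c : S) {r s : ℕ} (h : r ≤ s)
    (ht : ∀ u v, piOneMap c h u * piOneMap c h v = piOneMap c h v * piOneMap c h u) :
    CollapsesFree 1 c h := by
  rintro f g ⟨γ, hγ⟩
  let φ := piOneMap c h
  let F : FundamentalGroup (TileSpace S s) (basePt c s) := .fromPath (.mk (loopPath f))
  let G : FundamentalGroup (TileSpace S s) (basePt c s) := .fromPath (.mk (loopPath g))
  let V : FundamentalGroup (TileSpace S s) (basePt c s) := .fromPath (.mk γ)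
  -- Products in the fundamental group are read from right to left.
  have e : V * F = G * V := Path.Homotopic.Quotient.eq.2 hγ.loopPath_trans
  have e1 : φ F = φ G := by
    have e2 : φ V * φ F = φ G * φ V := by rw [← map_mul, e, map_mul]
    rw [← ht V G] at e2
    exact mul_left_cancel e2
  change piOneMap c h _ = piOneMap c h _ at e1
  rw [piOneMap_mk, piOneMap_mk] at e1
  exact homotopic_of_loopPath (Path.Homotopic.Quotient.exact e1)

/-- Move both loops to d along β, compare them there, and return along the image of β. The total
track goes along a path and back, hence is null-homotopic. -/
theorem CollapsesFree.of_joined {c d : S} {r s : ℕ} {h : r ≤ s} (hd : CollapsesFree k d h)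
    (hj : Joined (basePt d s) (basePt c s)) : CollapsesFree k c h := by
  intro f g hfg
  obtain ⟨β⟩ := hj
  obtain ⟨f', hf⟩ := TrackHomotopic.exists_left β f
  obtain ⟨g', hg⟩ := TrackHomotopic.exists_left β g
  have h1 := hd f' g' ((FreelyHomotopic.trans ⟨β, hf⟩ hfg).trans ⟨β.symm, hg.symm⟩)
  have hf' := hf.map (restrictMap S h).spaceMap (restrict_basePt d h) (restrict_basePt c h)
  have hg' := hg.map (restrictMap S h).spaceMap (restrict_basePt d h) (restrict_basePt c h)
  refine ((hf'.symm.trans (.of_homotopic h1)).trans hg').homotopic ?_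
  exact (Path.Homotopic.hcomp ⟨Path.Homotopy.transRefl _⟩ (.refl _)).trans
    ⟨(Path.Homotopy.reflSymmTrans _).symm⟩

/-- Vertex injectivity gives the degenerate alternative; in the weakly mixing cases path
connectedness carries the property from one base point to all. -/
theorem IsBasepointFree.collapsesFree [TopologicalSpace A] [DiscreteTopology A]
    (hS : ∀ v, shift v '' S = S) (hb : IsBasepointFree S k) :
    S.Subsingleton ∨ ∀ c : S, (∀ r (y : TileSpace S r), Joined (basePt c r) y) ∧
      ∀ r, ∃ s, ∃ h : r ≤ s, CollapsesFree k c h := by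
  rcases hb with ⟨r₀, h⟩ | ⟨hw, rfl, d, h⟩ | ⟨hw, d, h⟩
  · exact .inl (subsingleton_of_vertexInjective hS (le_max_right r₀ 1) (h _ (le_max_left _ _)))
  · refine .inr fun c => ⟨fun r y => joined_basePt_point hS hw c y, fun r => ?_⟩
    obtain ⟨s, hrs, hc⟩ := h r
    exact ⟨s, hrs, (collapsesFree_of_comm d hrs hc).of_joined (joined_basePt hS hw s d c)⟩
  · refine .inr fun c => ⟨fun r y => joined_basePt_point hS hw c y, fun r => ?_⟩
    obtain ⟨s, hrs, hc⟩ := h r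
    exact ⟨s, hrs, (collapsesFree_of_trivial d hrs hc).of_joined (joined_basePt hS hw s d c)⟩

theorem restrict_restrict {r s t : ℕ} (h : r ≤ s) (h' : s ≤ t) (x : TileSpace S t) :
    (restrictMap S h).spaceMap ((restrictMap S h').spaceMap x) =
      (restrictMap S (h.trans h')).spaceMap x := by
  induction x using Quot.ind
  rfl

/-- If `π_k Φ` is injective, a compatible family of free homotopy classes of loops in the spaces
`X_r` whose image under `Φ` is trivial is itself trivial. -/
theorem homotopic_const_of_injective {Φ : Config D A → Config D A} {q : ℕ} (hq : HasRadius Φ q)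
    (hS : MapsTo Φ S S) (c : S) (hj : ∀ r (y : TileSpace S r), Joined (basePt c r) y)
    (hc : ∀ r, ∃ s, ∃ h : r ≤ s, CollapsesFree k c h)
    (hinj : Function.Injective (projPiMap hq hS k c)) {y : ∀ r, TileSpace S r}
    (g : ∀ r, GenLoop (Fin k) (TileSpace S r) (y r))
    (hg : ∀ r s (h : r ≤ s),
      FreelyHomotopic (mapLoop (restrictMap S h).spaceMap rfl (g s)) (g r))
    (hΦ : ∀ r, ∃ y', FreelyHomotopic (mapLoop (caMap hq hS r).spaceMap rfl (g (r + q)))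
      (GenLoop.const : GenLoop (Fin k) (TileSpace S r) y')) (r : ℕ) :
    GenLoop.Homotopic (g r) GenLoop.const := by
  -- The connecting paths are chosen independently for each r, so the moved loops are compatible
  -- only up to free homotopy.
  have hf : ∀ r, ∃ f : GenLoop (Fin k) (TileSpace S r) (basePt c r), FreelyHomotopic f (g r) := by
    intro r
    obtain ⟨γ⟩ := hj r (y r)
    obtain ⟨f, hf⟩ := TrackHomotopic.exists_left γ (g r)
    exact ⟨f, γ, hf⟩
  choose f hf using hf
  choose m hm hcol using hc
  have hfr : ∀ r s (h : r ≤ s), FreelyHomotopic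
      (mapLoop (restrictMap S h).spaceMap (restrict_basePt c h) (f s)) (f r) := fun r s h =>
    (((hf s).map (restrictMap S h).spaceMap (restrict_basePt c h) rfl).trans (hg r s h)).trans
      (hf r).symm
  -- Descending from level `m r` to level r turns free compatibility into compatibility of based
  -- classes.
  let w : ∀ r, GenLoop (Fin k) (TileSpace S r) (basePt c r) := fun r =>
    mapLoop (restrictMap S (hm r)).spaceMap (restrict_basePt c (hm r)) (f (m r))
  have hcomp : ∀ {r s t : ℕ} (h : r ≤ s) (h' : s ≤ t)
      (l : GenLoop (Fin k) (TileSpace S t) (basePt c t)),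
      mapLoop (restrictMap S h).spaceMap (restrict_basePt c h)
        (mapLoop (restrictMap S h').spaceMap (restrict_basePt c h') l) =
      mapLoop (restrictMap S (h.trans h')).spaceMap (restrict_basePt c (h.trans h')) l :=
    fun h h' l => GenLoop.ext _ _ fun p => restrict_restrict h h' (l p)
  have hw1 : ∀ r s (h : m r ≤ s), GenLoop.Homotopic (w r)
      (mapLoop (restrictMap S ((hm r).trans h)).spaceMap (restrict_basePt c _) (f s)) := by
    intro r s h
    rw [← hcomp (hm r) h]
    exact hcol r _ _ (hfr _ _ h).symm
  -- The classes at r and r' are compared through the moved loop at the common level `max (m r) (m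
  -- r')`.
  let W : ProjPi k c := ⟨fun r => ⟦w r⟧, fun r r' h => Quotient.sound (by
    have hs := le_max_left (m r) (m r')
    have hs' := le_max_right (m r) (m r')
    have e := mapLoop_homotopic (restrictMap S h).spaceMap (restrict_basePt c h) (hw1 r' _ hs')
    rw [hcomp h ((hm r').trans hs') (f _)] at e
    exact e.trans (hw1 r _ hs).symm)⟩
  let O : ProjPi k c := ⟨fun r => ⟦GenLoop.const⟧, fun r r' h => Quotient.sound (by
    rw [mapLoop_const])⟩
  have hwg : ∀ r, FreelyHomotopic (w r) (g r) := fun r => (hfr _ _ (hm r)).trans (hf r)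
  -- The image of `w` is freely homotopic to a constant, hence null-homotopic; no control of the
  -- track is needed.
  have hWO : projPiMap hq hS k c W = projPiMap hq hS k c O := by
    refine Subtype.ext (funext fun r => Quotient.sound ?_)
    obtain ⟨y', hy'⟩ := hΦ r
    rw [mapLoop_const]
    exact (((hwg (r + q)).map (caMap hq hS r).spaceMap (caMap_basePt hq hS c r) rfl).trans
      hy').homotopic_const
  have hW : W.1 r = O.1 r := by rw [hinj hWO]
  exact ((hwg r).symm.trans (.of_homotopic (Quotient.exact hW))).homotopic_const

theorem not_mem_of_homotopyDefect (hS : ∀ v, shift v '' S = S) {a : Config D A}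
    (h : HasHomotopyDefect S k a) : a ∉ S := by
  intro ha
  obtain ⟨-, ω, u, r, hr⟩ := h
  refine hr ?_
  obtain ⟨⟨t, l⟩, hl⟩ := Quot.exists_rep (u.1 r)
  have hl0 : GenLoop.Homotopic l GenLoop.const :=
    homotopic_const_of_retract ⟨fun p => p.1, continuous_subtype_val⟩
      ⟨fun p => ⟨p, mem_thicken_of_mem hS ha r p⟩, by fun_prop⟩ (fun _ => rfl) l
  have e := mapLoop_homotopic (sectionMap S a r) rfl hl0
  rw [mapLoop_const] at e
  change RayPi.IsOne (RayPi.map _ (ω.rayAt_dom_subset r) (fun _ => rfl) (u.1 r))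
  rw [← hl]
  exact RayPi.isOne_of_homotopic e

/-- A proper base ray for `a` is a proper base ray for `Φ a`. -/
def ProperBaseRay.image {Φ : Config D A → Config D A} {q : ℕ} (hq : HasRadius Φ q)
    (hS : MapsTo Φ S S) {a : Config D A} (ω : ProperBaseRay S a) : ProperBaseRay S (Φ a) where
  toFun := ω.toFun
  continuous_toFun := ω.continuous_toFun
  tendsto_norm := ω.tendsto_norm
  eventually_mem r := (ω.eventually_mem (r + q)).mono fun _ ht =>
    thicken_mono (unflawed_subset_image hq hS a r) ht

/-- The inclusion of `G_(r+q)(a)` into `G_r(Φ a)`. -/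
def regionImageMap {Φ : Config D A → Config D A} {q : ℕ} (hq : HasRadius Φ q)
    (hS : MapsTo Φ S S) (a : Config D A) (r : ℕ) :
    C(thicken (unflawed S a (r + q)), thicken (unflawed S (Φ a) r)) :=
  ⟨fun p => ⟨p.1, thicken_mono (unflawed_subset_image hq hS a r) p.2⟩, by fun_prop⟩

theorem ProperBaseRay.rayAt_dom_image {Φ : Config D A → Config D A} {q : ℕ} (hq : HasRadius Φ q)
    (hS : MapsTo Φ S S) {a : Config D A} (ω : ProperBaseRay S a) (r : ℕ) :
    (ω.rayAt (r + q)).dom ⊆ ((ω.image hq hS).rayAt r).dom :=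
  fun _ ht t' ht' => thicken_mono (unflawed_subset_image hq hS a r) (ht t' ht')

/-- The map `π_k(G_∞(a), ω) → π_k(G_∞(Φ a), ω)` induced by the inclusions. -/
noncomputable def regionPiImage {Φ : Config D A → Config D A} {q : ℕ} (hq : HasRadius Φ q)
    (hS : MapsTo Φ S S) {a : Config D A} (ω : ProperBaseRay S a) (u : RegionPi k ω) :
    RegionPi k (ω.image hq hS) :=
  ⟨fun r => RayPi.map (regionImageMap hq hS a r) (ω.rayAt_dom_image hq hS r) (fun _ => rfl)
    (u.1 (r + q)), fun r s h =>
    (RayPi.map_square (regionImageMap hq hS a s) (regionMap S (Φ a) h)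
      (regionMap S a (Nat.add_le_add_right h q)) (regionImageMap hq hS a r)
      _ (fun _ => rfl) _ (fun _ => rfl) (ω.rayAt_dom (Nat.add_le_add_right h q)) (fun _ => rfl)
      _ (fun _ => rfl) (fun _ => rfl) _).trans
    (congrArg _ (u.2 _ _ (Nat.add_le_add_right h q)))⟩

/-- The same ray serves Φ a. If Φ a had no homotopy defect, the representatives of the signature of
`a` would be freely compatible loops with freely trivial Φ-images, hence null-homotopic. -/
theorem HasHomotopyDefect.image [TopologicalSpace A] [DiscreteTopology A]
    (hinv : ∀ v, shift v '' S = S) (hb : IsBasepointFree S k)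
    {Φ : Config D A → Config D A} {q : ℕ} (hq : HasRadius Φ q) (hS : MapsTo Φ S S) (c : S)
    (hinj : Function.Injective (projPiMap hq hS k c)) {a : Config D A}
    (h : HasHomotopyDefect S k a) : HasHomotopyDefect S k (Φ a) := by
  obtain ⟨ha, ω, u, r₀, hr₀⟩ := h
  refine ⟨image_mem_slightlyDefective hq hS ha, ?_⟩
  by_contra hno
  refine hr₀ ?_
  choose l hl using fun r => Quot.exists_rep (u.1 r)
  let g : ∀ r, GenLoop (Fin k) (TileSpace S r) (sectionMap S a r ((ω.rayAt r).pt (l r).1)) :=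
    fun r => mapLoop (sectionMap S a r) rfl (l r).2
  -- Triviality of a class along the ray can be checked on one representative at its own base point.
  have hone : GenLoop.Homotopic (g r₀) GenLoop.const → ((homotopySignature k ω u).1 r₀).IsOne := by
    intro h0
    change RayPi.IsOne (RayPi.map _ (ω.rayAt_dom_subset r₀) (fun _ => rfl) (u.1 r₀))
    rw [← hl r₀]
    exact RayPi.isOne_of_homotopic h0
  refine hone ?_
  rcases hb.collapsesFree hinv with hsub | hfree
  · exact homotopic_const_of_subsingleton hinv hsub c _
  obtain ⟨hj, hc⟩ := hfree c
  refine homotopic_const_of_injective hq hS c hj hc hinj g (fun r s h => ?_) (fun r => ?_) r₀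
  · have e := u.2 r s h
    rw [← hl r, ← hl s] at e
    have e1 := (RayPi.freelyHomotopic e).map (sectionMap S a r) rfl rfl
    exact (FreelyHomotopic.of_eq (restrict_sectionMap a h _)
      fun p => restrict_sectionMap a h ((l s).2 p)).trans e1
  · have h1 : ((homotopySignature k (ω.image hq hS) (regionPiImage hq hS ω u)).1 r).IsOne := by
      by_contra h1
      exact hno ⟨_, _, r, h1⟩
    change RayPi.IsOne (RayPi.map _ ((ω.image hq hS).rayAt_dom_subset r) (fun _ => rfl)
      (RayPi.map _ (ω.rayAt_dom_image hq hS r) (fun _ => rfl) (u.1 (r + q)))) at h1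
    rw [← hl (r + q)] at h1
    obtain ⟨t, ht⟩ := h1
    exact ⟨_, (FreelyHomotopic.of_eq (caMap_sectionMap hq hS a r _)
      fun p => caMap_sectionMap hq hS a r ((l (r + q)).2 p)).trans (RayPi.freelyHomotopic ht)⟩

end HomotopyDefects

end CADefect

open CADefect
theorem corollary3p4 {D : ℕ} (hD : 1 ≤ D) {A : Type*} [Finite A] [TopologicalSpace A]
    [DiscreteTopology A] (S : Set (Config D A)) (hSFT : IsSFT S)
    (Φ : Config D A → Config D A) (hΦ : IsCA Φ) (hS : Set.MapsTo Φ S S) (k : ℕ) (hk : 1 ≤ k) :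
    (IsBasepointFree S k → ∀ c : S, Function.Injective (projPiMap hΦ.hasRadius hS k c) →
      ∀ a : Config D A, HasHomotopyDefect S k a → IsPersistent S Φ a) ∧
    (∀ (G : Type*) [AddCommGroup G],
      (Function.Injective (projHomologyMap G k hΦ.hasRadius hS) →
        ∀ a : Config D A, HasHomologyDefect S G k a → IsPersistent S Φ a) ∧
      (Function.Surjective (projCohomologyMap G k hΦ.hasRadius hS) →
        ∀ a : Config D A, HasCohomologyDefect S G k a → IsPersistent S Φ a)) := by
  have hinv := hSFT.1.2
  refine ⟨fun hb c hinj a ha => ?_, fun G _ => ⟨fun hinj a ha => ?_, fun hsurj a ha => ?_⟩⟩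
  · exact isPersistent_of_step (P := HasHomotopyDefect S k) (fun _ h => h.1)
      (fun _ h => not_mem_of_homotopyDefect hinv h)
      (fun _ h => h.image hinv hb hΦ.hasRadius hS c hinj) ha
  · exact isPersistent_of_step (P := HasHomologyDefect S G k) (fun _ h => h.1)
      (fun _ h => not_mem_of_homologyDefect G hinv hk h)
      (fun _ h => h.image G hΦ.hasRadius hS hinj) ha
  · exact isPersistent_of_step (P := HasCohomologyDefect S G k) (fun _ h => h.1)
      (fun _ h => not_mem_of_cohomologyDefect G hinv hk h)
      (fun _ h => h.image G hΦ.hasRadius hS hsurj) ha
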